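/- Let $1\le A\le Q$, $A\le S$ and $L\ge 1$ be integers. Consider a time-slotted transmitter with queue length $q[n]\in\{0,\dots,Q\}$, arrivals $a[n]\in\{0,\dots,A\}$ and channel state $h[n]\in\{h_1,\dots,h_L\}\subset\mathbb{C}$, where $0<|h_1|<\dots<|h_L|$. The arrivals form an irreducible Markov chain with transition probabilities $\gamma_{a,a'}$ and steady-state distribution $\phi$; put $\alpha=\sum_a a\,\phi_a$. The channel states are i.i.d. with $\Pr\{h[n]=h_\iota\}=\eta_\iota$. A policy $\boldsymbol F=\{f_{q,a,\iota}^s\}$ prescribes the probability $f_{q,a,\iota}^s$ of transmitting $s\in\{0,\dots,S\}$ packets in state $(q,a,h_\iota)$, where $\sum_s f_{q,a,\iota}^s=1$ and $f_{q,a,\iota}^s=0$ unless $\max\{q-Q+A,0\}\le s\le\min\{q,S\}$; the queue evolves as $q[n+1]=q[n]-s[n]+a[n+1]$. For each $\iota$ the power function $P_{h_\iota}$ on $\{0,\dots,S\}$ is nondecreasing and convex with $P_{h_\iota}(0)=0$. For an initial state at time $0$, the average power and average delay of $\boldsymbol F$ are $P_{\boldsymbol F}=\lim_N\frac1N\mathbb{E}\sum_{n=1}^N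 P_{h[n]}(s[n])$ and $D_{\boldsymbol F}=\lim_N\frac1N\mathbb{E}\,\frac1\alpha\sum_{n=1}^N q[n]$. For a power budget $P_{\rm th}$, a policy is optimal if it minimizes $D_{\boldsymbol F}$ among all policies with $P_{\boldsymbol F}\le P_{\rm th}$. Assume that for all $1\le\iota^-<\iota^+\le L$ and $0\le s^-<s^+\le S$, $$P_{h_{\iota^+}}(s^+)-P_{h_{\iota^+}}(s^-)\le P_{h_{\iota^-}}(s^+)-P_{h_{\iota^-}}(s^-).$$ Let $P_{\rm th}\in\mathbb R$ be such that some policy, from some initial state, has average power at most $P_{\rm th}$. Then there are a policy $\boldsymbol F^*$ that is optimal for $P_{\rm th}$ from every initial state, and thresholds $0\le q(0,a,\iota)\le q(1,a,\iota)\le\dots\le q(S,a,\iota)\le Q$ (with $q(-1,a,\iota)=-1$) such that: 1. there is a triple $(s^*,a^*,\iota^*)$ such that $\boldsymbol F^*$ transmits $s$ packets with probability $1$ whenever $q(s-1,a,\iota)<q\le q(s,a,\iota)$, except that in the single state with $q=q(s^*,a^*,\iota^*)$, $a=a^*$, $\iota=\iota^*$ the rate may be randomized between $s^*$ and $s^*+1$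 (when $s^*=S$, it is $s^*$); 2. $q(s,a,\iota^+)\le q(s,a,\iota^-)$ for all $s$, all $a$ and all $1\le\iota^-<\iota^+\le L$. That is, a better channel state uses a higher rate at the same queue length. -/

import Mathlib

open Filter Topology

/-- Data and standing assumptions of an adaptive transmitter with a buffer of size `Q`, at most `A`
arrivals and at most `S` transmitted packets per timeslot, and an `L`-state block fading channel. -/
structure LinkModel (Q A S L : ℕ) where
  /-- arrivals can occur, so that the mean arrival rate (a denominator below) is positive -/
  one_le_A : 1 ≤ A
  A_le_Q : A ≤ Q
  A_le_S : A ≤ S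
  /-- `γ a a'` is the probability that `a'` packets arrive after a timeslot with `a` arrivals -/
  γ : Matrix (Fin (A + 1)) (Fin (A + 1)) ℝ
  γ_nonneg : ∀ a a', 0 ≤ γ a a'
  γ_sum : ∀ a, ∑ a', γ a a' = 1
  /-- ergodicity of the arrival chain (aperiodicity is not needed) -/
  γ_irreducible : γ.IsIrreducible
  /-- the steady-state distribution of the arrival chain -/
  φ : Fin (A + 1) → ℝ
  φ_nonneg : ∀ a, 0 ≤ φ a
  φ_sum : ∑ a, φ a = 1
  φ_stationary : ∀ a', ∑ a, φ a * γ a a' = φ a'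
  /-- the channel states, from the worst to the best -/
  h : Fin L → ℂ
  h_pos : ∀ i, 0 < ‖h i‖
  h_strictMono : StrictMono fun i => ‖h i‖
  /-- the law of the i.i.d. channel state -/
  η : Fin L → ℝ
  η_nonneg : ∀ i, 0 ≤ η i
  η_sum : ∑ i, η i = 1
  /-- `P g s` is the power needed to transmit `s` packets when the channel coefficient is `g` -/
  P : ℂ → ℕ → ℝ
  P_zero : ∀ i, P (h i) 0 = 0
  P_mono : ∀ i s, s + 1 ≤ S → P (h i) s ≤ P (h i) (s + 1)
  P_convex : ∀ i s, s + 2 ≤ S → 2 * P (h i) (s + 1) ≤ P (h i) s + P (h i) (s + 2)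

namespace LinkModel

variable {Q A S L : ℕ}

/-- System states: queue length, number of arrivals, index of the channel state. -/
abbrev State (Q A L : ℕ) : Type := Fin (Q + 1) × Fin (A + 1) × Fin L

/-- `s ∈ 𝒮(q)`, that is `max {q - Q + A, 0} ≤ s ≤ min {q, S}` (and `s ≤ S` holds by typing). -/
def Feasible (Q A : ℕ) {S : ℕ} (q : Fin (Q + 1)) (s : Fin (S + 1)) : Prop :=
  (q : ℕ) + A ≤ Q + (s : ℕ) ∧ (s : ℕ) ≤ (q : ℕ)

/-- `F (q, a, i) s` is the probability to transmit `s` packets in the state `(q, a, i)`. -/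
structure IsPolicy (F : State Q A L → Fin (S + 1) → ℝ) : Prop where
  nonneg : ∀ z s, 0 ≤ F z s
  sum_eq_one : ∀ z, ∑ s, F z s = 1
  eq_zero : ∀ z s, ¬ Feasible Q A z.1 s → F z s = 0

/-- The mean number of arrivals in a timeslot. -/
noncomputable def α (M : LinkModel Q A S L) : ℝ := ∑ a : Fin (A + 1), ((a : ℕ) : ℝ) * M.φ a

/-- The transition matrix of the system state under the policy `F`. -/
noncomputable def transition (M : LinkModel Q A S L) (F : State Q A L → Fin (S + 1) → ℝ) :
    Matrix (State Q A L) (State Q A L) ℝ :=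
  fun z z' => ∑ s : Fin (S + 1), F z s * (M.γ z.2.1 z'.2.1 * M.η z'.2.2 *
    (if (z'.1 : ℕ) + (s : ℕ) = (z.1 : ℕ) + (z'.2.1 : ℕ) then 1 else 0))

/-- `E_z[c(z[n])]`: the mean of the cost `c` of the system state in timeslot `n`, under the policy
`F` and with the initial state `z` in timeslot `0`. -/
noncomputable def meanCost (M : LinkModel Q A S L) (F : State Q A L → Fin (S + 1) → ℝ)
    (c : State Q A L → ℝ) (z : State Q A L) (n : ℕ) : ℝ :=
  ∑ z', (M.transition F ^ n) z z' * c z'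

/-- The long-term average of the cost `c` under `F` from the initial state `z` exists and is `v`. -/
def HasAvgCost (M : LinkModel Q A S L) (F : State Q A L → Fin (S + 1) → ℝ)
    (c : State Q A L → ℝ) (z : State Q A L) (v : ℝ) : Prop :=
  Tendsto (fun N : ℕ => (1 / (N : ℝ)) * ∑ n ∈ Finset.Icc 1 N, M.meanCost F c z n) atTop (𝓝 v)

/-- The average power under the policy `F` from the initial state `z` is `p`. -/
def HasAvgPower (M : LinkModel Q A S L) (F : State Q A L → Fin (S + 1) → ℝ)
    (z : State Q A L) (p : ℝ) : Prop :=
  M.HasAvgCost F (fun z' => ∑ s : Fin (S + 1), F z' s * M.P (M.h z'.2.2) (s : ℕ)) z p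

/-- The average delay under the policy `F` from the initial state `z` is `d`. -/
def HasAvgDelay (M : LinkModel Q A S L) (F : State Q A L → Fin (S + 1) → ℝ)
    (z : State Q A L) (d : ℝ) : Prop :=
  M.HasAvgCost F (fun z' => (1 / M.α) * ((z'.1 : ℕ) : ℝ)) z d

/-- From the initial state `z`, the policy `F` has the least average delay among the policies whose
average power is at most `Pth`. -/
def IsOptimal (M : LinkModel Q A S L) (Pth : ℝ) (F : State Q A L → Fin (S + 1) → ℝ)
    (z : State Q A L) : Prop :=
  IsPolicy F ∧ ∃ d p, M.HasAvgDelay F z d ∧ M.HasAvgPower F z p ∧ p ≤ Pth ∧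
    ∀ F' : State Q A L → Fin (S + 1) → ℝ, IsPolicy F' →
      ∀ d' p', M.HasAvgDelay F' z d' → M.HasAvgPower F' z p' → p' ≤ Pth → d ≤ d'

/-- The threshold `t (s - 1) a i`, with the convention `t (-1) a i = -1`. -/
def prevThreshold (t : Fin (S + 1) → Fin (A + 1) → Fin L → Fin (Q + 1))
    (s : Fin (S + 1)) (a : Fin (A + 1)) (i : Fin L) : ℤ :=
  if (s : ℕ) = 0 then -1 else ((t ⟨(s : ℕ) - 1, by omega⟩ a i : ℕ) : ℤ)

/-- `F` has the threshold structure with thresholds `t`: with `a` arrivals and channel state `i`,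
the rate is `s` if the queue length is in `(t (s - 1) a i, t s a i]`, except that at the queue
length `t s₀ a₀ i₀`, for `a₀` arrivals and channel state `i₀`, the rate may be randomized between
`s₀` and `s₀ + 1`. -/
structure HasThresholds (F : State Q A L → Fin (S + 1) → ℝ)
    (t : Fin (S + 1) → Fin (A + 1) → Fin L → Fin (Q + 1))
    (s₀ : Fin (S + 1)) (a₀ : Fin (A + 1)) (i₀ : Fin L) : Prop where
  mono : ∀ s s' a i, s ≤ s' → t s a i ≤ t s' a i
  regular : ∀ (q : Fin (Q + 1)) a i s, (a ≠ a₀ ∨ s ≠ s₀ ∨ i ≠ i₀) →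
    prevThreshold t s a i < ((q : ℕ) : ℤ) → q ≤ t s a i → F (q, a, i) s = 1
  special : ∀ q : Fin (Q + 1), prevThreshold t s₀ a₀ i₀ < ((q : ℕ) : ℤ) → q < t s₀ a₀ i₀ → F (q, a₀, i₀) s₀ = 1
  mixed : ∑ s : Fin (S + 1),
    (if s = s₀ ∨ (s : ℕ) = (s₀ : ℕ) + 1 then F (t s₀ a₀ i₀, a₀, i₀) s else 0) = 1
  otherwise : ∀ (q : Fin (Q + 1)) a i s,
    ¬ ((a ≠ a₀ ∨ s ≠ s₀ ∨ i ≠ i₀) ∧ prevThreshold t s a i < ((q : ℕ) : ℤ) ∧ q ≤ t s a i) →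
    ¬ (a = a₀ ∧ s = s₀ ∧ i = i₀ ∧ prevThreshold t s a i < ((q : ℕ) : ℤ) ∧ q < t s a i) →
    ¬ (a = a₀ ∧ i = i₀ ∧ q = t s₀ a₀ i₀ ∧ (s = s₀ ∨ (s : ℕ) = (s₀ : ℕ) + 1)) →
    F (q, a, i) s = 0

end LinkModel

/-! Price the power by a multiplier `lam ≥ 0` and minimize delay plus `lam` times power. Convexity
in the queue length survives the Bellman operator (`ConvexQueue.bellman`) and the vanishing-discount
limit (`exists_isBellman`). With a convex relative value function, exchange arguments show that
optimal rates can be chosen as a rule (`IsRule`): one more packet in the queue raises the rate by 0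
or 1, and a better channel never lowers it. Rules form a lattice, and the optimal rates in each
state form an interval.

Unless the multiplier is zero, it can be chosen so that two rules on either side of the budget are
both optimal for the relaxed problem (`exists_multiplier`). After clipping (`exists_clip`) they are
optimal in every state, and unit changes through optimal rules join them via their infimum. Some
unit change crosses the budget (`exists_crossing`), and randomizing between its two ends meets the
budget exactly (`exists_mix_power`). Complementary slackness gives optimality; the thresholds are
the jumps of the lower rule.

The chain of a rule may have several recurrent classes, so its average power might depend on the
initial state. A coupling excludes this for rules and their mixtures (`exists_power_mix`): one extra
packet changes the total power over any horizon by a bounded amount, and irreducibility of the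
arrivals does the rest. -/

section Stochastic

/-! ### Averages and stationary laws of finite stochastic matrices -/

open Matrix

variable {X : Type*} [Fintype X] {T : Matrix X X ℝ}

lemma exists_abs_le (w : X → ℝ) : ∃ K, ∀ x, |w x| ≤ K :=
  ⟨∑ x, |w x|, fun x => Finset.single_le_sum (f := fun x => |w x|)
    (fun _ _ => abs_nonneg _) (Finset.mem_univ x)⟩

/-- `π` is a stationary distribution of the matrix `T`. -/
structure IsStationaryLaw (T : Matrix X X ℝ) (π : X → ℝ) : Prop where
  nonneg : ∀ x, 0 ≤ π x
  sum_eq_one : ∑ x, π x = 1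
  vecMul_eq : π ᵥ* T = π

lemma IsStationaryLaw.dotProduct_mulVec {π : X → ℝ} (h : IsStationaryLaw T π) (v : X → ℝ) :
    π ⬝ᵥ (T *ᵥ v) = π ⬝ᵥ v := by
  rw [Matrix.dotProduct_mulVec, h.vecMul_eq]

lemma IsStationaryLaw.dotProduct_const {π : X → ℝ} (h : IsStationaryLaw T π) (k : ℝ) :
    π ⬝ᵥ (fun _ => k) = k := by
  simp only [dotProduct]
  rw [← Finset.sum_mul, h.sum_eq_one, one_mul]

variable [DecidableEq X]

lemma abs_mulVec_le_of_mem_rowStochastic (hT : T ∈ rowStochastic ℝ X) {w : X → ℝ} {K : ℝ}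
    (hw : ∀ x, |w x| ≤ K) (x : X) : |(T *ᵥ w) x| ≤ K := by
  calc |(T *ᵥ w) x| ≤ ∑ y, |T x y * w y| := Finset.abs_sum_le_sum_abs _ _
    _ ≤ ∑ y, T x y * K := by
        refine Finset.sum_le_sum fun y _ => ?_
        rw [abs_mul, abs_of_nonneg (nonneg_of_mem_rowStochastic hT)]
        exact mul_le_mul_of_nonneg_left (hw y) (nonneg_of_mem_rowStochastic hT)
    _ = K := by rw [← Finset.sum_mul, sum_row_of_mem_rowStochastic hT, one_mul]

lemma mulVec_mono_of_mem_rowStochastic (hT : T ∈ rowStochastic ℝ X) {v w : X → ℝ}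
    (h : ∀ x, v x ≤ w x) (x : X) : (T *ᵥ v) x ≤ (T *ᵥ w) x :=
  Finset.sum_le_sum fun y _ => mul_le_mul_of_nonneg_left (h y) (nonneg_of_mem_rowStochastic hT)

lemma mulVec_const_of_mem_rowStochastic (hT : T ∈ rowStochastic ℝ X) (k : ℝ) :
    T *ᵥ (fun _ => k) = fun _ => k := by
  funext x
  simp only [mulVec, dotProduct]
  rw [← Finset.sum_mul, sum_row_of_mem_rowStochastic hT, one_mul]

/-- The Cesàro averages of a stochastic matrix applied to a vector. -/
noncomputable def cesaro (T : Matrix X X ℝ) (c : X → ℝ) (x : X) (N : ℕ) : ℝ :=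
  (1 / (N : ℝ)) * ∑ n ∈ Finset.Icc 1 N, (T ^ n *ᵥ c) x

/-- The harmonic part accumulates linearly and the coboundary telescopes. The remainder stays
bounded, so averages converge without aperiodicity. -/
lemma sum_Icc_pow_mulVec_of_poisson {c p w : X → ℝ} (hp : T *ᵥ p = p)
    (hc : c = p + w - T *ᵥ w) (x : X) (N : ℕ) :
    ∑ n ∈ Finset.Icc 1 N, (T ^ n *ᵥ c) x = N * p x + (T *ᵥ w) x - (T ^ (N + 1) *ᵥ w) x := by
  have hpn : ∀ n, T ^ n *ᵥ p = p := by
    intro n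
    induction n with
    | zero => simp
    | succ n ih => rw [pow_succ, ← mulVec_mulVec, hp, ih]
  induction N with
  | zero => simp
  | succ N ih =>
    rw [Finset.sum_Icc_succ_top (by omega), ih, hc, mulVec_sub, mulVec_add, hpn, mulVec_mulVec,
      ← pow_succ]
    simp only [Pi.add_apply, Pi.sub_apply]
    push_cast
    ring

lemma tendsto_inv_mul_of_abs_sub_le {u : ℕ → ℝ} {l K : ℝ} (h : ∀ N : ℕ, |u N - N * l| ≤ K) :
    Tendsto (fun N : ℕ => (1 / (N : ℝ)) * u N) atTop (𝓝 l) := by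
  have h0 : Tendsto (fun N : ℕ => K / (N : ℝ)) atTop (𝓝 0) :=
    tendsto_const_div_atTop_nhds_zero_nat K
  rw [tendsto_iff_norm_sub_tendsto_zero]
  refine squeeze_zero' (Eventually.of_forall fun _ => norm_nonneg _) ?_ h0
  filter_upwards [eventually_gt_atTop 0] with N hN
  have hN' : (0 : ℝ) < N := by exact_mod_cast hN
  have : 1 / (N : ℝ) * u N - l = (u N - N * l) / N := by field_simp
  rw [this, Real.norm_eq_abs, abs_div, abs_of_pos hN']
  exact div_le_div_of_nonneg_right (h N) hN'.le

lemma tendsto_cesaro_of_poisson (hT : T ∈ rowStochastic ℝ X) {c p w : X → ℝ} (hp : T *ᵥ p = p)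
    (hc : c = p + w - T *ᵥ w) (x : X) : Tendsto (cesaro T c x) atTop (𝓝 (p x)) := by
  obtain ⟨K, hK⟩ := exists_abs_le w
  refine tendsto_inv_mul_of_abs_sub_le (K := K + K) fun N => ?_
  rw [sum_Icc_pow_mulVec_of_poisson hp hc]
  have h1 := abs_mulVec_le_of_mem_rowStochastic hT hK x
  have h2 := abs_mulVec_le_of_mem_rowStochastic (pow_mem hT (N + 1)) hK x
  rw [abs_le] at *
  constructor <;> linarith

/-- Every vector splits into a harmonic part and a coboundary of a stochastic matrix. -/
lemma exists_poisson (hT : T ∈ rowStochastic ℝ X) (c : X → ℝ) :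
    ∃ p w : X → ℝ, T *ᵥ p = p ∧ c = p + w - T *ᵥ w := by
  set f : (X → ℝ) →ₗ[ℝ] (X → ℝ) := LinearMap.id - T.mulVecLin with hf
  have hfa : ∀ v, f v = v - T *ᵥ v := fun v => by simp [hf]
  -- A common element has Cesàro limit itself, being harmonic, and limit zero, being a coboundary.
  -- Rank-nullity then makes kernel and range complementary.
  have hdisj : Disjoint (LinearMap.ker f) (LinearMap.range f) := by
    rw [Submodule.disjoint_def]
    rintro y hy ⟨w, rfl⟩
    rw [LinearMap.mem_ker, hfa, sub_eq_zero] at hy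
    have hp : T *ᵥ (0 : X → ℝ) = 0 := by simp
    funext x
    have h1 := tendsto_cesaro_of_poisson hT hp (c := f w) (w := w) (by rw [hfa]; simp) x
    have h2 := tendsto_cesaro_of_poisson hT (c := f w) (p := f w) (w := 0) hy.symm (by simp) x
    exact tendsto_nhds_unique h2 h1
  have htop : LinearMap.ker f ⊔ LinearMap.range f = ⊤ := by
    refine Submodule.eq_top_of_disjoint _ _ ?_ hdisj
    rw [add_comm, LinearMap.finrank_range_add_finrank_ker]
  have hc : c ∈ LinearMap.ker f ⊔ LinearMap.range f := by rw [htop]; trivial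
  obtain ⟨p, hp, y, ⟨w, rfl⟩, rfl⟩ := Submodule.mem_sup.1 hc
  refine ⟨p, w, ?_, ?_⟩
  · rw [LinearMap.mem_ker, hfa, sub_eq_zero] at hp
    exact hp.symm
  · rw [hfa]; abel

lemma exists_tendsto_cesaro (hT : T ∈ rowStochastic ℝ X) (c : X → ℝ) (x : X) :
    ∃ l, Tendsto (cesaro T c x) atTop (𝓝 l) := by
  obtain ⟨p, w, hp, hc⟩ := exists_poisson hT c
  exact ⟨_, tendsto_cesaro_of_poisson hT hp hc x⟩

lemma cesaro_add (c d : X → ℝ) (x : X) (N : ℕ) :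
    cesaro T (c + d) x N = cesaro T c x N + cesaro T d x N := by
  simp only [cesaro, mulVec_add, Pi.add_apply, Finset.sum_add_distrib, mul_add]

lemma cesaro_smul (k : ℝ) (c : X → ℝ) (x : X) (N : ℕ) :
    cesaro T (k • c) x N = k * cesaro T c x N := by
  simp only [cesaro, mulVec_smul, Pi.smul_apply, smul_eq_mul, ← Finset.mul_sum]
  ring

lemma cesaro_mono (hT : T ∈ rowStochastic ℝ X) {c d : X → ℝ} (h : ∀ x, c x ≤ d x) (x : X)
    (N : ℕ) : cesaro T c x N ≤ cesaro T d x N :=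
  mul_le_mul_of_nonneg_left (Finset.sum_le_sum fun n _ =>
    mulVec_mono_of_mem_rowStochastic (pow_mem hT n) h x) (by positivity)

/-- A lower bound of the one-step cost up to a coboundary bounds the average cost. -/
lemma le_of_tendsto_cesaro (hT : T ∈ rowStochastic ℝ X) {c V : X → ℝ} {g l : ℝ}
    (h : ∀ x, g + V x ≤ c x + (T *ᵥ V) x) (x : X) (hl : Tendsto (cesaro T c x) atTop (𝓝 l)) :
    g ≤ l := by
  have h1 : Tendsto (cesaro T ((fun _ => g) + V - T *ᵥ V) x) atTop (𝓝 g) :=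
    tendsto_cesaro_of_poisson hT (p := fun _ => g) (w := V) (mulVec_const_of_mem_rowStochastic hT g)
      rfl x
  refine le_of_tendsto_of_tendsto' h1 hl fun N => cesaro_mono hT (fun y => ?_) x N
  simp only [Pi.add_apply, Pi.sub_apply]
  linarith [h y]

/-- The Cesàro limits of a single row of the powers of `T` serve as the law. -/
lemma exists_isStationaryLaw [Nonempty X] (hT : T ∈ rowStochastic ℝ X) : ∃ π, IsStationaryLaw T π := by
  obtain ⟨x⟩ := ‹Nonempty X›
  have hlim : ∀ y, ∃ l, Tendsto (cesaro T (Pi.single y 1) x) atTop (𝓝 l) :=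
    fun y => exists_tendsto_cesaro hT _ x
  choose π hπ using hlim
  have hpow : ∀ n y, (T ^ n *ᵥ Pi.single y 1) x = (T ^ n) x y := by
    intro n y; simp
  refine ⟨π, fun y => ?_, ?_, ?_⟩
  · refine ge_of_tendsto' (hπ y) fun N => ?_
    refine mul_nonneg (by positivity) (Finset.sum_nonneg fun n _ => ?_)
    rw [hpow]
    exact nonneg_of_mem_rowStochastic (pow_mem hT n)
  · have h1 : Tendsto (cesaro T (fun _ => (1 : ℝ)) x) atTop (𝓝 1) :=
      tendsto_cesaro_of_poisson hT (p := fun _ => 1) (w := 0)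
        (mulVec_const_of_mem_rowStochastic hT 1) (by simp) x
    refine tendsto_nhds_unique (tendsto_finsetSum _ fun y _ => hπ y) (h1.congr fun N => ?_)
    simp only [cesaro, hpow, ← Finset.mul_sum]
    rw [Finset.sum_comm]
    congr 1
    refine Finset.sum_congr rfl fun n _ => ?_
    rw [mulVec_const_of_mem_rowStochastic (pow_mem hT n), sum_row_of_mem_rowStochastic (pow_mem hT n)]
  · funext y
    have h1 : Tendsto (fun N => ∑ k, cesaro T (Pi.single k 1) x N * T k y) atTop
        (𝓝 (∑ k, π k * T k y)) := tendsto_finsetSum _ fun k _ => (hπ k).mul_const _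
    refine tendsto_nhds_unique h1 ?_
    -- A coboundary has vanishing averages, so one further application of `T` does not change the
    -- limit.
    have h2 : Tendsto (cesaro T (T *ᵥ Pi.single y 1 - Pi.single y 1) x) atTop (𝓝 0) :=
      tendsto_cesaro_of_poisson hT (p := 0) (w := - Pi.single y 1) (by simp)
        (by simp [mulVec_neg]; abel) x
    have h3 := (hπ y).add h2
    rw [add_zero] at h3
    refine h3.congr fun N => ?_
    rw [← cesaro_add, add_sub_cancel]
    simp only [cesaro, hpow, Finset.mul_sum, Finset.sum_mul]
    rw [Finset.sum_comm]
    refine Finset.sum_congr rfl fun n _ => ?_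
    rw [mulVec_mulVec, ← pow_succ, hpow, pow_succ, mul_apply, Finset.mul_sum]
    exact Finset.sum_congr rfl fun k _ => by ring

end Stochastic

/-! ### One-step means of the controlled chain -/

namespace LinkModel

open Matrix

variable {Q A S L : ℕ}

/-- The queue length `n`, truncated at the buffer size. -/
def clamp (Q n : ℕ) : Fin (Q + 1) := ⟨min n Q, by omega⟩

lemma clamp_val {n : ℕ} (h : n ≤ Q) : (clamp Q n : ℕ) = n := min_eq_left h

/-- The mean of `V` at the next system state, if `u` packets are left in the queue after the
transmission and `a` packets have arrived last. -/
noncomputable def next (M : LinkModel Q A S L) (V : State Q A L → ℝ) (u : ℕ) (a : Fin (A + 1)) : ℝ :=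
  ∑ a' : Fin (A + 1), ∑ i', M.γ a a' * M.η i' * V (clamp Q (u + a'), a', i')

variable (M : LinkModel Q A S L)

lemma sum_weight (a : Fin (A + 1)) : ∑ a' : Fin (A + 1), ∑ i', M.γ a a' * M.η i' = 1 := by
  simp_rw [← Finset.mul_sum, M.η_sum, mul_one, M.γ_sum]

lemma weight_nonneg (a a' : Fin (A + 1)) (i : Fin L) : 0 ≤ M.γ a a' * M.η i :=
  mul_nonneg (M.γ_nonneg _ _) (M.η_nonneg _)

lemma next_mono {V W : State Q A L → ℝ} {u u' : ℕ} {a : Fin (A + 1)}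
    (h : ∀ (a' : Fin (A + 1)) i, V (clamp Q (u + a'), a', i) ≤ W (clamp Q (u' + a'), a', i)) :
    M.next V u a ≤ M.next W u' a :=
  Finset.sum_le_sum fun a' _ => Finset.sum_le_sum fun i _ =>
    mul_le_mul_of_nonneg_left (h a' i) (M.weight_nonneg _ _ _)

lemma next_const (k : ℝ) (u : ℕ) (a : Fin (A + 1)) : M.next (fun _ => k) u a = k := by
  simp only [next]
  simp_rw [← Finset.sum_mul]
  rw [M.sum_weight, one_mul]

lemma next_add (V W : State Q A L → ℝ) (u : ℕ) (a : Fin (A + 1)) :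
    M.next (V + W) u a = M.next V u a + M.next W u a := by
  simp only [next, Pi.add_apply, mul_add, Finset.sum_add_distrib]

lemma next_smul (k : ℝ) (V : State Q A L → ℝ) (u : ℕ) (a : Fin (A + 1)) :
    M.next (k • V) u a = k * M.next V u a := by
  simp only [next, Pi.smul_apply, smul_eq_mul, Finset.mul_sum]
  exact Finset.sum_congr rfl fun _ _ => Finset.sum_congr rfl fun _ _ => by ring

lemma next_le_of_le {V : State Q A L → ℝ} {k : ℝ} {u : ℕ} {a : Fin (A + 1)}
    (h : ∀ (a' : Fin (A + 1)) i, V (clamp Q (u + a'), a', i) ≤ k) : M.next V u a ≤ k :=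
  (M.next_mono (W := fun _ => k) (u' := u) h).trans (M.next_const k u a).le

lemma le_next_of_le {V : State Q A L → ℝ} {k : ℝ} {u : ℕ} {a : Fin (A + 1)}
    (h : ∀ (a' : Fin (A + 1)) i, k ≤ V (clamp Q (u + a'), a', i)) : k ≤ M.next V u a :=
  (M.next_const k u a).ge.trans (M.next_mono (V := fun _ => k) (u := u) h)

variable {M}

/-- Truncated subtraction and `clamp` are harmless at feasible rates, which satisfy `s ≤ q` and
leave room for `A` arrivals; all other rates have probability zero. -/
lemma transition_mulVec {F : State Q A L → Fin (S + 1) → ℝ} (hF : IsPolicy F)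
    (V : State Q A L → ℝ) (z : State Q A L) :
    (M.transition F *ᵥ V) z = ∑ s : Fin (S + 1), F z s * M.next V (z.1 - s) z.2.1 := by
  simp only [mulVec, dotProduct, transition, Finset.sum_mul]
  rw [Finset.sum_comm]
  refine Finset.sum_congr rfl fun s _ => ?_
  by_cases hs : Feasible Q A z.1 s
  swap
  · simp [hF.eq_zero z s hs]
  obtain ⟨h1, h2⟩ := hs
  simp only [mul_assoc, ← Finset.mul_sum, next]
  congr 1
  rw [Fintype.sum_prod_type, Finset.sum_comm, Fintype.sum_prod_type]
  refine Finset.sum_congr rfl fun a' _ => ?_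
  rw [Finset.mul_sum]
  refine Finset.sum_congr rfl fun i _ => ?_
  have hle : (z.1 : ℕ) - s + a' ≤ Q := by have := a'.2; omega
  rw [Finset.sum_eq_single (clamp Q (z.1 - s + a'))]
  · rw [if_pos (by simp only [clamp_val hle]; omega)]
    ring
  · intro q _ hq
    rw [if_neg]
    · ring
    · intro h
      exact hq (Fin.ext (by simp only [clamp_val hle]; simp only at h; omega))
  · simp

lemma transition_mem_rowStochastic {F : State Q A L → Fin (S + 1) → ℝ} (hF : IsPolicy F) :
    M.transition F ∈ rowStochastic ℝ (State Q A L) := by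
  refine ⟨fun z z' => Finset.sum_nonneg fun s _ => mul_nonneg (hF.nonneg _ _) <|
    mul_nonneg (M.weight_nonneg _ _ _) (by split_ifs <;> norm_num), ?_⟩
  funext z
  rw [transition_mulVec hF]
  have : ∀ u, M.next 1 u z.2.1 = 1 := fun u => M.next_const 1 u z.2.1
  simp [this, hF.sum_eq_one]

/-- The mean cost in a state under the policy `F`. -/
noncomputable def policyCost (F : State Q A L → Fin (S + 1) → ℝ)
    (c : State Q A L → Fin (S + 1) → ℝ) (z : State Q A L) : ℝ := ∑ s, F z s * c z s

/-- The policy that transmits `f z` packets in the state `z`. -/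
noncomputable def pure (f : State Q A L → Fin (S + 1)) (z : State Q A L) (s : Fin (S + 1)) : ℝ :=
  if s = f z then 1 else 0

lemma sum_pure_mul (f : State Q A L → Fin (S + 1)) (z : State Q A L) (k : Fin (S + 1) → ℝ) :
    ∑ s, pure f z s * k s = k (f z) := by
  simp [pure]

lemma isPolicy_pure {f : State Q A L → Fin (S + 1)} (hf : ∀ z, Feasible Q A z.1 (f z)) :
    IsPolicy (pure f) where
  nonneg z s := by unfold pure; split_ifs <;> norm_num
  sum_eq_one z := by simp [pure]
  eq_zero z s h := by
    unfold pure
    rw [if_neg]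
    rintro rfl
    exact h (hf z)

end LinkModel

/-! ### Monotone rules and the constancy of their average power -/

namespace LinkModel

open Matrix

variable {Q A S L : ℕ}

/-- A deterministic policy whose rate and remaining queue length are both nondecreasing in the
queue length, and whose rate is nondecreasing in the channel index. -/
structure IsRule (f : State Q A L → Fin (S + 1)) : Prop where
  feasible : ∀ z, Feasible Q A z.1 (f z)
  mono : ∀ (q q' : Fin (Q + 1)) a i, (q' : ℕ) = q + 1 → (f (q, a, i) : ℕ) ≤ f (q', a, i)
  lip : ∀ (q q' : Fin (Q + 1)) a i, (q' : ℕ) = q + 1 → (f (q', a, i) : ℕ) ≤ f (q, a, i) + 1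
  channel : ∀ q a i j, i < j → (f (q, a, i) : ℕ) ≤ f (q, a, j)

/-- The randomization between two deterministic policies. -/
noncomputable def mix (θ : ℝ) (f f' : State Q A L → Fin (S + 1)) (z : State Q A L)
    (s : Fin (S + 1)) : ℝ := (1 - θ) * pure f z s + θ * pure f' z s

lemma sum_mix_mul (θ : ℝ) (f f' : State Q A L → Fin (S + 1)) (z : State Q A L)
    (k : Fin (S + 1) → ℝ) : ∑ s, mix θ f f' z s * k s = (1 - θ) * k (f z) + θ * k (f' z) := by
  simp only [mix, add_mul, mul_assoc, Finset.sum_add_distrib, ← Finset.mul_sum, sum_pure_mul]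

lemma mix_self (θ : ℝ) (f : State Q A L → Fin (S + 1)) : mix θ f f = pure f := by
  funext z s; simp only [mix]; ring

lemma isPolicy_mix {θ : ℝ} (h0 : 0 ≤ θ) (h1 : θ ≤ 1) {f f' : State Q A L → Fin (S + 1)}
    (hf : ∀ z, Feasible Q A z.1 (f z)) (hf' : ∀ z, Feasible Q A z.1 (f' z)) :
    IsPolicy (mix θ f f') where
  nonneg z s := add_nonneg (mul_nonneg (by linarith) ((isPolicy_pure hf).nonneg z s))
    (mul_nonneg h0 ((isPolicy_pure hf').nonneg z s))
  sum_eq_one z := by simpa using sum_mix_mul θ f f' z 1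
  eq_zero z s h := by
    simp [mix, (isPolicy_pure hf).eq_zero z s h, (isPolicy_pure hf').eq_zero z s h]

variable (M : LinkModel Q A S L)

/-- The power spent in the state `z` at the rate `s`. -/
noncomputable def power (z : State Q A L) (s : Fin (S + 1)) : ℝ := M.P (M.h z.2.2) s

lemma exists_power_step_le : ∃ C, ∀ i s, s + 1 ≤ S → M.P (M.h i) (s + 1) - M.P (M.h i) s ≤ C := by
  obtain ⟨C, hC⟩ := exists_abs_le
    (fun x : Fin L × Fin S => M.P (M.h x.1) (x.2 + 1) - M.P (M.h x.1) x.2)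
  exact ⟨C, fun i s hs => (le_abs_self _).trans (hC (i, ⟨s, by omega⟩))⟩

/-- Coupling: with a rule, one packet more in the queue is either kept or transmitted. -/
lemma step_sub_mem {C : ℝ}
    (hC : ∀ i s, s + 1 ≤ S → M.P (M.h i) (s + 1) - M.P (M.h i) s ≤ C)
    {f : State Q A L → Fin (S + 1)} (hf : IsRule f) {V : State Q A L → ℝ}
    (hV : ∀ (q q' : Fin (Q + 1)) a i, (q' : ℕ) = q + 1 →
      V (q, a, i) ≤ V (q', a, i) ∧ V (q', a, i) ≤ V (q, a, i) + C)
    (q q' : Fin (Q + 1)) (a : Fin (A + 1)) (i : Fin L) (hq : (q' : ℕ) = q + 1) :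
    M.power (q, a, i) (f (q, a, i)) + M.next V (q - f (q, a, i)) a ≤
        M.power (q', a, i) (f (q', a, i)) + M.next V (q' - f (q', a, i)) a ∧
      M.power (q', a, i) (f (q', a, i)) + M.next V (q' - f (q', a, i)) a ≤
        M.power (q, a, i) (f (q, a, i)) + M.next V (q - f (q, a, i)) a + C := by
  have h1 := hf.mono q q' a i hq
  have h2 := hf.lip q q' a i hq
  obtain ⟨hfe, hle⟩ := hf.feasible (q, a, i)
  obtain ⟨hfe', hle'⟩ := hf.feasible (q', a, i)
  simp only at hfe hle hfe' hle'
  simp only [power]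
  -- Either the extra packet is sent, leaving equal queues and a bounded power difference, or it is
  -- kept and the bound is inherited from `V`.
  rcases Nat.lt_or_ge (f (q, a, i)) (f (q', a, i)) with hlt | hge
  · have hs : (f (q', a, i) : ℕ) = f (q, a, i) + 1 := by omega
    have hu : (q' : ℕ) - f (q', a, i) = q - f (q, a, i) := by omega
    have hS : (f (q, a, i) : ℕ) + 1 ≤ S := by have := (f (q', a, i)).2; omega
    rw [hu, hs]
    exact ⟨by linarith [M.P_mono i _ hS], by linarith [hC i _ hS]⟩
  · have hs : (f (q', a, i) : ℕ) = f (q, a, i) := by omega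
    have hu : (q' : ℕ) - f (q', a, i) = q - f (q, a, i) + 1 := by omega
    rw [hu, hs]
    have key : ∀ (a' : Fin (A + 1)) j, V (clamp Q (q - f (q, a, i) + a'), a', j) ≤
        V (clamp Q (q - f (q, a, i) + 1 + a'), a', j) ∧
        V (clamp Q (q - f (q, a, i) + 1 + a'), a', j) ≤
        V (clamp Q (q - f (q, a, i) + a'), a', j) + C := by
      intro a' j
      have := a'.2
      exact hV _ _ _ _ (by rw [clamp_val (by omega), clamp_val (by omega)]; omega)
    refine ⟨by linarith [M.next_mono (V := V) (W := V) (a := a) fun a' j => (key a' j).1], ?_⟩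
    have := M.next_mono (V := V) (W := V + fun _ => C) (a := a) fun a' j => (key a' j).2
    rw [next_add, next_const] at this
    linarith

lemma eq_of_forall_mul_sub_le {x y K : ℝ} (h : ∀ N : ℕ, |N * (x - y)| ≤ K) : x = y := by
  by_contra hne
  have hpos : 0 < |x - y| := abs_pos.2 (sub_ne_zero.2 hne)
  obtain ⟨N, hN⟩ := exists_nat_gt (K / |x - y|)
  rw [div_lt_iff₀ hpos] at hN
  have := h N
  rw [abs_mul, Nat.abs_cast] at this
  linarith

lemma reflTransGen_arrivals (a b : Fin (A + 1)) :
    Relation.ReflTransGen (fun a a' => 0 < M.γ a a') a b := by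
  obtain ⟨p, -⟩ := M.γ_irreducible.connected a b
  induction p with
  | nil => exact .refl
  | cons _ e ih => exact ih.tail e.down

/-- A function of the arrivals that is harmonic for the arrival chain is constant. -/
lemma eq_of_harmonic {r : Fin (A + 1) → ℝ} (hr : ∀ a, r a = ∑ a', M.γ a a' * r a')
    (a b : Fin (A + 1)) : r a = r b := by
  obtain ⟨m, hm⟩ := Finite.exists_max r
  -- Maximum principle: an average can equal the maximum only if every value of positive weight
  -- does.
  have hstep : ∀ x y, 0 < M.γ x y → r x = r m → r y = r m := by
    intro x y hxy hx
    by_contra hne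
    have hlt : r y < r m := lt_of_le_of_ne (hm y) hne
    have : ∑ a', M.γ x a' * r a' < ∑ a', M.γ x a' * r m :=
      Finset.sum_lt_sum (fun a' _ => mul_le_mul_of_nonneg_left (hm a') (M.γ_nonneg _ _))
        ⟨y, Finset.mem_univ _, mul_lt_mul_of_pos_left hlt hxy⟩
    rw [← hr, ← Finset.sum_mul, M.γ_sum, one_mul, hx] at this
    exact lt_irrefl _ this
  have hall : ∀ y, r y = r m := by
    intro y
    have := M.reflTransGen_arrivals m y
    induction this with
    | refl => rfl
    | tail _ h ih => exact hstep _ _ h ih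
  rw [hall a, hall b]

variable {M}

/-- The average power of a randomization between two rules does not depend on the initial state. -/
lemma exists_power_mix {θ : ℝ} (h0 : 0 ≤ θ) (h1 : θ ≤ 1) {f f' : State Q A L → Fin (S + 1)}
    (hf : IsRule f) (hf' : IsRule f') :
    ∃ P w, policyCost (mix θ f f') M.power =
      (fun _ => P) + w - M.transition (mix θ f f') *ᵥ w := by
  set F := mix θ f f' with hFdef
  have hF : IsPolicy F := isPolicy_mix h0 h1 hf.feasible hf'.feasible
  have hT := transition_mem_rowStochastic (M := M) hF
  set T := M.transition F with hTdef
  obtain ⟨p, w, hp, hc⟩ := exists_poisson hT (policyCost F M.power)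
  obtain ⟨C, hC⟩ := M.exists_power_step_le
  -- The induction below starts from the zero function and needs a nonnegative bound.
  have hC' : ∀ i s, s + 1 ≤ S → M.P (M.h i) (s + 1) - M.P (M.h i) s ≤ |C| :=
    fun i s hs => (hC i s hs).trans (le_abs_self C)
  have hpn : ∀ n : ℕ, T ^ n *ᵥ p = p := by
    intro n
    induction n with
    | zero => simp
    | succ n ih => rw [pow_succ, ← mulVec_mulVec, hp, ih]
  -- By the Poisson equation this vector is the expected total power over `N` timeslots including
  -- the initial one. The coupling bounds its increments in the queue length uniformly in `N`, which
  -- forces `p` not to depend on `q`.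
  have hW : ∀ (N : ℕ) (q q' : Fin (Q + 1)) a i, (q' : ℕ) = q + 1 →
      ((N : ℝ) • p + w - T ^ N *ᵥ w) (q, a, i) ≤ ((N : ℝ) • p + w - T ^ N *ᵥ w) (q', a, i) ∧
      ((N : ℝ) • p + w - T ^ N *ᵥ w) (q', a, i) ≤
        ((N : ℝ) • p + w - T ^ N *ᵥ w) (q, a, i) + |C| := by
    intro N
    induction N with
    | zero => intro q q' a i _; simp
    | succ N ih =>
      intro q q' a i hq
      set W := (N : ℝ) • p + w - T ^ N *ᵥ w with hWdef
      have hrec : ((N + 1 : ℕ) : ℝ) • p + w - T ^ (N + 1) *ᵥ w = policyCost F M.power + T *ᵥ W := by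
        rw [hWdef, hc, mulVec_sub, mulVec_add, mulVec_smul, hp, mulVec_mulVec, ← pow_succ']
        push_cast
        module
      have hval : ∀ z, (policyCost F M.power + T *ᵥ W) z =
          (1 - θ) * (M.power z (f z) + M.next W (z.1 - f z) z.2.1) +
            θ * (M.power z (f' z) + M.next W (z.1 - f' z) z.2.1) := by
        intro z
        rw [Pi.add_apply, hTdef, transition_mulVec hF, policyCost, hFdef,
          sum_mix_mul _ _ _ _ (M.power z),
          sum_mix_mul _ _ _ _ (fun s : Fin (S + 1) => M.next W (z.1 - s) z.2.1)]
        ring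
      rw [hrec, hval, hval]
      have e1 := M.step_sub_mem hC' hf ih q q' a i hq
      have e2 := M.step_sub_mem hC' hf' ih q q' a i hq
      simp only
      have h1' : 0 ≤ 1 - θ := by linarith
      constructor
      · linarith [mul_le_mul_of_nonneg_left e1.1 h1', mul_le_mul_of_nonneg_left e2.1 h0]
      · linarith [mul_le_mul_of_nonneg_left e1.2 h1', mul_le_mul_of_nonneg_left e2.2 h0]
  obtain ⟨K, hK⟩ := exists_abs_le w
  have hadj : ∀ (q q' : Fin (Q + 1)) a i, (q' : ℕ) = q + 1 → p (q', a, i) = p (q, a, i) := by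
    intro q q' a i hq
    refine eq_of_forall_mul_sub_le (K := |C| + 4 * K) fun N => ?_
    have h2 := hW N q q' a i hq
    simp only [Pi.add_apply, Pi.sub_apply, Pi.smul_apply, smul_eq_mul] at h2
    have k1 := abs_le.1 (hK (q, a, i))
    have k2 := abs_le.1 (hK (q', a, i))
    have k3 := abs_le.1 (abs_mulVec_le_of_mem_rowStochastic (pow_mem hT N) hK (q, a, i))
    have k4 := abs_le.1 (abs_mulVec_le_of_mem_rowStochastic (pow_mem hT N) hK (q', a, i))
    have := abs_nonneg C
    rw [abs_le]
    constructor <;> linarith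
  have hq0 : ∀ (n : ℕ) (hn : n < Q + 1) a i, p (⟨n, hn⟩, a, i) = p (0, a, i) := by
    intro n
    induction n with
    | zero => intro _ _ _; rfl
    | succ n ih => intro hn a i; rw [hadj ⟨n, by omega⟩ ⟨n + 1, hn⟩ a i rfl, ih]
  have hq : ∀ q a i, p (q, a, i) = p (0, a, i) := fun q a i => hq0 q q.2 a i
  -- Averaged over the channel, `p` becomes a harmonic function of the arrivals alone.
  set r : Fin (A + 1) → ℝ := fun a => ∑ i, M.η i * p (0, a, i) with hr
  have hnext : ∀ u a, M.next p u a = ∑ a', M.γ a a' * r a' := by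
    intro u a
    simp only [next, hr, Finset.mul_sum, hq]
    exact Finset.sum_congr rfl fun _ _ => Finset.sum_congr rfl fun _ _ => by ring
  have hpr : ∀ z, p z = ∑ a', M.γ z.2.1 a' * r a' := by
    intro z
    conv_lhs => rw [← hp]
    rw [hTdef, transition_mulVec hF]
    simp_rw [hnext]
    rw [← Finset.sum_mul, hF.sum_eq_one, one_mul]
  have hrr : ∀ a, r a = ∑ a', M.γ a a' * r a' := by
    intro a
    conv_lhs => rw [hr]
    simp only [hpr]
    rw [← Finset.sum_mul, M.η_sum, one_mul]
  have hpc : p = fun _ => r 0 := by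
    funext z
    rw [hpr, ← hrr]
    exact M.eq_of_harmonic hrr _ _
  exact ⟨r 0, w, by rw [← hpc]; exact hc⟩

end LinkModel

/-! ### Discrete convexity and the Bellman operator -/

/-- Midpoint convexity of a function on `{0, …, n}`. -/
def DiscreteConvex (n : ℕ) (f : ℕ → ℝ) : Prop := ∀ k, k + 2 ≤ n → 2 * f (k + 1) ≤ f k + f (k + 2)

/-- Increments of a convex sequence are nondecreasing, so moving both arguments inward loses
nothing. For `y = x + 1` they merely trade places. -/
lemma DiscreteConvex.exchange {n : ℕ} {f : ℕ → ℝ} (hf : DiscreteConvex n f) {x y : ℕ} (hxy : x < y)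
    (hy : y ≤ n) : f (x + 1) + f (y - 1) ≤ f x + f y := by
  obtain ⟨d, rfl⟩ := Nat.exists_eq_add_of_lt hxy
  induction d with
  | zero => simp [add_comm]
  | succ d ih =>
    have h1 := ih (by omega) (by omega)
    have h2 := hf (x + d) (by omega)
    have e1 : x + (d + 1) + 1 - 1 = x + d + 1 := by omega
    have e2 : x + (d + 1) + 1 = x + d + 2 := by omega
    rw [e1, e2]
    simp only [add_tsub_cancel_right] at h1
    linarith

/-- Two splittings of `q` and `q + 1` into a transmitted and a kept part: exchange of the
transmitted parts. -/
lemma DiscreteConvex.exchange_kept {m : ℕ} {v : ℕ → ℝ} (hv : DiscreteConvex m v)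
    {q s₁ s₂ : ℕ} (h : s₂ < s₁) (h₁ : s₁ ≤ q) (h₂ : q + 1 ≤ m + s₂) :
    v (q - s₂) + v (q + 1 - s₁) ≤ v (q - s₁) + v (q + 1 - s₂) := by
  have := hv.exchange (x := q - s₁) (y := q + 1 - s₂) (by omega) (by omega)
  have e1 : q - s₁ + 1 = q + 1 - s₁ := by omega
  have e2 : q + 1 - s₂ - 1 = q - s₂ := by omega
  rw [e1, e2] at this
  linarith

namespace LinkModel

variable {Q A S L : ℕ}

instance decidableFeasible (q : Fin (Q + 1)) (s : Fin (S + 1)) : Decidable (Feasible Q A q s) :=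
  inferInstanceAs (Decidable (_ ∧ _))

/-- The feasible rates at the queue length `q`. -/
def feasibleRates (Q A S : ℕ) (q : Fin (Q + 1)) : Finset (Fin (S + 1)) :=
  Finset.univ.filter fun s => Feasible Q A q s

lemma mem_feasibleRates {q : Fin (Q + 1)} {s : Fin (S + 1)} :
    s ∈ feasibleRates Q A S q ↔ Feasible Q A q s := by simp [feasibleRates]

variable (M : LinkModel Q A S L)

lemma feasibleRates_nonempty (M : LinkModel Q A S L) (q : Fin (Q + 1)) : (feasibleRates Q A S q).Nonempty := by
  have h1 := M.A_le_Q
  have h2 := M.A_le_S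
  have h3 := q.2
  exact ⟨⟨min q A, by omega⟩, mem_feasibleRates.2 ⟨by simp only; omega, by simp only; omega⟩⟩

/-- The Lagrangian cost of transmitting `s` packets in the state `z`. -/
noncomputable def stage (lam : ℝ) (z : State Q A L) (s : Fin (S + 1)) : ℝ :=
  1 / M.α * (z.1 : ℕ) + lam * M.power z s

/-- The Bellman operator with discount factor `β`. -/
noncomputable def bellman (lam β : ℝ) (V : State Q A L → ℝ) (z : State Q A L) : ℝ :=
  (feasibleRates Q A S z.1).inf' (M.feasibleRates_nonempty z.1)
    fun s => M.stage lam z s + β * M.next V (z.1 - s) z.2.1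

lemma bellman_le {lam β : ℝ} (V : State Q A L → ℝ) {z : State Q A L} {s : Fin (S + 1)}
    (hs : Feasible Q A z.1 s) :
    M.bellman lam β V z ≤ M.stage lam z s + β * M.next V (z.1 - s) z.2.1 :=
  Finset.inf'_le (fun s => M.stage lam z s + β * M.next V (z.1 - s) z.2.1)
    (mem_feasibleRates.2 hs)

lemma exists_bellman_eq (lam β : ℝ) (V : State Q A L → ℝ) (z : State Q A L) :
    ∃ s : Fin (S + 1), Feasible Q A z.1 s ∧
      M.bellman lam β V z = M.stage lam z s + β * M.next V (z.1 - s) z.2.1 := by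
  obtain ⟨s, hs, h⟩ := Finset.exists_mem_eq_inf' (M.feasibleRates_nonempty z.1)
    (fun s => M.stage lam z s + β * M.next V (z.1 - s) z.2.1)
  exact ⟨s, mem_feasibleRates.1 hs, h⟩

lemma bellman_mono {lam β : ℝ} (hβ : 0 ≤ β) {V W : State Q A L → ℝ} (h : ∀ z, V z ≤ W z)
    (z : State Q A L) : M.bellman lam β V z ≤ M.bellman lam β W z := by
  obtain ⟨s, hs, e⟩ := M.exists_bellman_eq lam β W z
  rw [e]
  refine (M.bellman_le V hs).trans ?_
  have := M.next_mono (V := V) (W := W) (u := z.1 - s) (u' := z.1 - s) (a := z.2.1) fun _ _ => h _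
  nlinarith

lemma tendsto_next {ι : Type*} {l : Filter ι} {V : ι → State Q A L → ℝ} {W : State Q A L → ℝ}
    (h : ∀ z, Tendsto (fun n => V n z) l (𝓝 (W z))) (u : ℕ) (a : Fin (A + 1)) :
    Tendsto (fun n => M.next (V n) u a) l (𝓝 (M.next W u a)) :=
  tendsto_finsetSum _ fun _ _ => tendsto_finsetSum _ fun _ _ => (h _).const_mul _

lemma tendsto_bellman {ι : Type*} {l : Filter ι} {V : ι → State Q A L → ℝ} {W : State Q A L → ℝ}
    {b : ι → ℝ} {β : ℝ} (lam : ℝ) (hb : Tendsto b l (𝓝 β))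
    (h : ∀ z, Tendsto (fun n => V n z) l (𝓝 (W z))) (z : State Q A L) :
    Tendsto (fun n => M.bellman lam (b n) (V n) z) l (𝓝 (M.bellman lam β W z)) :=
  Tendsto.finset_inf'_nhds_apply _ fun _ _ =>
    tendsto_const_nhds.add (hb.mul (M.tendsto_next h _ _))

/-- Convexity in the queue length. -/
def ConvexQueue (V : State Q A L → ℝ) : Prop :=
  ∀ a i, DiscreteConvex Q fun q => V (clamp Q q, a, i)

variable {M}

/-- Stopping at `Q - A` ensures that `clamp` truncates no arrivals; an average of convex functions
is convex. -/
lemma ConvexQueue.next {V : State Q A L → ℝ} (hV : ConvexQueue V) (a : Fin (A + 1)) :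
    DiscreteConvex (Q - A) fun u => M.next V u a := by
  intro u hu
  have hA := M.A_le_Q
  have : M.next ((2 : ℝ) • V) (u + 1) a ≤ M.next V u a + M.next V (u + 2) a := by
    simp only [LinkModel.next, Pi.smul_apply, smul_eq_mul, ← Finset.sum_add_distrib, ← mul_add]
    refine Finset.sum_le_sum fun a' _ => Finset.sum_le_sum fun i _ =>
      mul_le_mul_of_nonneg_left ?_ (M.weight_nonneg _ _ _)
    have := a'.2
    have := hV a' i (u + a') (by omega)
    rwa [show u + a' + 1 = u + 1 + a' by omega, show u + (a' : ℕ) + 2 = u + 2 + a' by omega] at this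
  rwa [next_smul] at this

lemma DiscreteConvex.const_mul {n : ℕ} {f : ℕ → ℝ} (hf : DiscreteConvex n f) {k : ℝ} (hk : 0 ≤ k) :
    DiscreteConvex n fun x => k * f x := by
  intro x hx
  have := mul_le_mul_of_nonneg_left (hf x hx) hk
  simp only
  linarith

lemma convex_power (M : LinkModel Q A S L) {lam : ℝ} (hl : 0 ≤ lam) (i : Fin L) :
    DiscreteConvex S fun s => lam * M.P (M.h i) s :=
  DiscreteConvex.const_mul (fun s hs => M.P_convex i s hs) hl

/-- Optimal rates at `q` and `q + 2` yield two rates at `q + 1` of no greater total cost. If `s₁ <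
s₂`, the rates move inward, the kept parts are unchanged, and convexity of the power decides.
Otherwise the rates stay and convexity of the continuation decides. -/
lemma ConvexQueue.bellman {lam β : ℝ} (hl : 0 ≤ lam) (hβ : 0 ≤ β) {V : State Q A L → ℝ}
    (hV : ConvexQueue V) : ConvexQueue (M.bellman lam β V) := by
  intro a i q hq
  have hA := M.A_le_Q
  have hv := DiscreteConvex.const_mul (hV.next (M := M) a) hβ
  have hp := M.convex_power hl i
  set v := fun u => β * M.next V u a with hvd
  obtain ⟨s₁, hs₁, e₁⟩ := M.exists_bellman_eq lam β V (clamp Q q, a, i)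
  obtain ⟨s₂, hs₂, e₂⟩ := M.exists_bellman_eq lam β V (clamp Q (q + 2), a, i)
  have hc0 : (clamp Q q : ℕ) = q := clamp_val (by omega)
  have hc1 : (clamp Q (q + 1) : ℕ) = q + 1 := clamp_val (by omega)
  have hc2 : (clamp Q (q + 2) : ℕ) = q + 2 := clamp_val hq
  obtain ⟨f₁, g₁⟩ := hs₁
  obtain ⟨f₂, g₂⟩ := hs₂
  simp only [hc0] at f₁ g₁
  simp only [hc2] at f₂ g₂
  have b₁ := s₁.2
  have b₂ := s₂.2
  have key : ∀ s : Fin (S + 1), q + 1 + A ≤ Q + s → (s : ℕ) ≤ q + 1 →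
      M.bellman lam β V (clamp Q (q + 1), a, i) ≤
        1 / M.α * (q + 1) + lam * M.P (M.h i) s + v (q + 1 - s) := by
    intro s h1 h2
    have := M.bellman_le (lam := lam) (β := β) V (z := (clamp Q (q + 1), a, i)) (s := s)
      ⟨by simp only [hc1]; omega, by simp only [hc1]; omega⟩
    simpa only [stage, power, hc1, Nat.cast_add, Nat.cast_one, hvd] using this
  simp only
  rw [e₁, e₂]
  simp only [stage, power, hc0, hc2, Nat.cast_add, Nat.cast_ofNat]
  change _ ≤ _ + v (q - s₁) + (_ + v (q + 2 - s₂))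
  rcases Nat.lt_or_ge s₁ s₂ with h | h
  · have k1 := key ⟨s₁ + 1, by omega⟩ (by simp only; omega) (by simp only; omega)
    have k2 := key ⟨s₂ - 1, by omega⟩ (by simp only; omega) (by simp only; omega)
    have := hp.exchange h (by omega)
    simp only at k1 k2 this
    rw [show q + 1 - (s₁ + 1 : ℕ) = q - s₁ by omega] at k1
    rw [show q + 1 - (s₂ - 1 : ℕ) = q + 2 - s₂ by omega] at k2
    linarith
  · have k1 := key s₁ (by omega) (by omega)
    have k2 := key s₂ (by omega) (by omega)
    have := hv.exchange (x := q - s₁) (y := q + 2 - s₂) (by omega) (by omega)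
    rw [show q - (s₁ : ℕ) + 1 = q + 1 - s₁ by omega,
      show q + 2 - (s₂ : ℕ) - 1 = q + 1 - s₂ by omega] at this
    linarith

lemma alpha_nonneg (M : LinkModel Q A S L) : 0 ≤ M.α :=
  Finset.sum_nonneg fun a _ => mul_nonneg (by positivity) (M.φ_nonneg a)

lemma P_nonneg (M : LinkModel Q A S L) (i : Fin L) : ∀ s, s ≤ S → 0 ≤ M.P (M.h i) s := by
  intro s
  induction s with
  | zero => intro _; rw [M.P_zero]
  | succ s ih => intro hs; exact (ih (by omega)).trans (M.P_mono i s hs)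

lemma stage_nonneg (M : LinkModel Q A S L) {lam : ℝ} (hl : 0 ≤ lam) (z : State Q A L)
    (s : Fin (S + 1)) : 0 ≤ M.stage lam z s :=
  add_nonneg (mul_nonneg (one_div_nonneg.2 M.alpha_nonneg) (by positivity))
    (mul_nonneg hl (M.P_nonneg _ _ (by omega)))

lemma exists_stage_le (M : LinkModel Q A S L) (lam : ℝ) : ∃ C, 0 ≤ C ∧ ∀ z s, M.stage lam z s ≤ C := by
  obtain ⟨C, hC⟩ := exists_abs_le fun x : State Q A L × Fin (S + 1) => M.stage lam x.1 x.2
  exact ⟨|C|, abs_nonneg C, fun z s =>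
    (le_abs_self _).trans ((hC (z, s)).trans (le_abs_self C))⟩

lemma bellman_nonneg {lam β : ℝ} (hl : 0 ≤ lam) (hβ : 0 ≤ β) {V : State Q A L → ℝ}
    (hV : ∀ z, 0 ≤ V z) (z : State Q A L) : 0 ≤ M.bellman lam β V z := by
  obtain ⟨s, -, e⟩ := M.exists_bellman_eq lam β V z
  rw [e]
  exact add_nonneg (M.stage_nonneg hl z s) (mul_nonneg hβ (M.le_next_of_le fun _ _ => hV _))

/-- The discounted Bellman equation has a nonnegative convex solution. -/
lemma exists_discounted (M : LinkModel Q A S L) {lam β : ℝ} (hl : 0 ≤ lam) (hβ : 0 ≤ β)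
    (hβ1 : β < 1) : ∃ V : State Q A L → ℝ, M.bellman lam β V = V ∧ (∀ z, 0 ≤ V z) ∧ ConvexQueue V := by
  obtain ⟨C, hC0, hC⟩ := M.exists_stage_le lam
  -- The solution of `C + β * B = B` bounds all value iterates started at zero.
  set B := C / (1 - β) with hB
  have hβ' : 0 < 1 - β := by linarith
  have hBC : C + β * B = B := by rw [hB]; field_simp; ring
  set U : ℕ → State Q A L → ℝ := fun n => (M.bellman lam β)^[n] 0 with hU
  have hsucc : ∀ n, U (n + 1) = M.bellman lam β (U n) := fun n =>
    Function.iterate_succ_apply' _ _ _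
  have h0 : ∀ n z, 0 ≤ U n z := by
    intro n
    induction n with
    | zero => intro z; exact le_rfl
    | succ n ih => intro z; rw [hsucc]; exact bellman_nonneg hl hβ ih z
  have hmono : ∀ z, Monotone fun n => U n z := by
    intro z
    refine monotone_nat_of_le_succ fun n => ?_
    induction n generalizing z with
    | zero => exact h0 1 z
    | succ n ih =>
      rw [hsucc, hsucc (n + 1)]
      exact M.bellman_mono hβ ih z
  have hbdd : ∀ n z, U n z ≤ B := by
    intro n
    induction n with
    | zero => intro z; exact div_nonneg hC0 hβ'.le
    | succ n ih =>
      intro z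
      rw [hsucc]
      obtain ⟨s, hs⟩ := M.feasibleRates_nonempty z.1
      refine (M.bellman_le _ (mem_feasibleRates.1 hs)).trans ?_
      rw [← hBC]
      exact add_le_add (hC z s) (mul_le_mul_of_nonneg_left (M.next_le_of_le fun _ _ => ih _) hβ)
  set V : State Q A L → ℝ := fun z => ⨆ n, U n z with hV
  have hlim : ∀ z, Tendsto (fun n => U n z) atTop (𝓝 (V z)) := fun z =>
    tendsto_atTop_ciSup (hmono z) ⟨B, by rintro _ ⟨n, rfl⟩; exact hbdd n z⟩
  have hconv : ∀ n, ConvexQueue (U n) := by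
    intro n
    induction n with
    | zero => intro a i q _; simp [hU]
    | succ n ih => rw [hsucc]; exact ih.bellman hl hβ
  refine ⟨V, ?_, fun z => ge_of_tendsto' (hlim z) fun n => h0 n z, fun a i q hq => ?_⟩
  · funext z
    refine tendsto_nhds_unique (M.tendsto_bellman lam tendsto_const_nhds hlim z) ?_
    simp_rw [← hsucc]
    exact (hlim z).comp (tendsto_add_atTop_nat 1)
  · exact le_of_tendsto_of_tendsto' ((hlim _).const_mul 2) ((hlim _).add (hlim _))
      fun n => hconv n a i q hq

/-! ### Bounded span and the vanishing discount -/

/-- Possible transitions of the pair of the queue length after the transmission and the number of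
arrivals. -/
def Move (M : LinkModel Q A S L) (x y : ℕ × Fin (A + 1)) : Prop :=
  0 < M.γ x.2 y.2 ∧ x.1 + A ≤ Q ∧ y.1 + A ≤ Q ∧ y.1 ≤ x.1 + y.2 ∧ x.1 + y.2 ≤ y.1 + S

/-- Sending exactly the new arrivals, possible since `A ≤ S`, holds the kept queue fixed. -/
lemma reach_arrivals (M : LinkModel Q A S L) {u : ℕ} (hu : u + A ≤ Q) (a b : Fin (A + 1)) :
    Relation.ReflTransGen M.Move (u, a) (u, b) := by
  have hS := M.A_le_S
  have := M.reflTransGen_arrivals a b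
  induction this with
  | refl => exact .refl
  | @tail c d _ h ih =>
    have := d.2
    exact ih.tail ⟨h, hu, hu, by simp, by simp only; omega⟩

lemma exists_pred (M : LinkModel Q A S L) {a b : Fin (A + 1)} (h : a ≠ b) : ∃ x, 0 < M.γ x b := by
  rcases Relation.ReflTransGen.cases_tail (M.reflTransGen_arrivals a b) with h' | ⟨x, -, hx⟩
  · exact absurd h'.symm h
  · exact ⟨x, hx⟩

/-- The kept queue can rise by one when `A` packets arrive and fall by one when none do; since `1 ≤
A`, irreducibility gives both events a predecessor. Every path is routed through the empty queue. -/
lemma reach (M : LinkModel Q A S L) {u w : ℕ} (hu : u + A ≤ Q) (hw : w + A ≤ Q)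
    (a b : Fin (A + 1)) : Relation.ReflTransGen M.Move (u, a) (w, b) := by
  have hA := M.one_le_A
  have hS := M.A_le_S
  have hne : (0 : Fin (A + 1)) ≠ Fin.last A := by
    intro h
    have := congrArg Fin.val h
    simp at this
    omega
  have hup : ∀ w, w + A ≤ Q → ∀ b, Relation.ReflTransGen M.Move (0, a) (w, b) := by
    intro w
    induction w with
    | zero => intro hw b; exact M.reach_arrivals hw a b
    | succ w ih =>
      intro hw b
      obtain ⟨x, hx⟩ := M.exists_pred hne
      have h1 := (ih (by omega) x).tail (c := (w + 1, Fin.last A))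
        ⟨hx, by simp only; omega, hw, by simp only [Fin.val_last]; omega,
          by simp only [Fin.val_last]; omega⟩
      exact h1.trans (M.reach_arrivals hw _ b)
  have hdown : ∀ u, u + A ≤ Q → ∀ a b, Relation.ReflTransGen M.Move (u, a) (0, b) := by
    intro u
    induction u with
    | zero => intro hu a b; exact M.reach_arrivals hu a b
    | succ u ih =>
      intro hu a b
      obtain ⟨x, hx⟩ := M.exists_pred hne.symm
      have h1 := (M.reach_arrivals hu a x).tail (c := (u, 0))
        ⟨hx, hu, by simp only; omega, by simp, by simp; omega⟩
      exact h1.trans (ih (by omega) _ b)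
  exact (hdown u hu a a).trans (hup w hw b)

/-- One step of the deficit of a discounted value function below its maximum. -/
lemma deficit_step {lam β C m : ℝ} (hC : ∀ z s, M.stage lam z s ≤ C)
    (hβ1 : β ≤ 1) {V : State Q A L → ℝ} (hfix : M.bellman lam β V = V)
    (h0 : ∀ z, 0 ≤ V z) (hm : ∀ u a, u + A ≤ Q → M.next V u a ≤ m) {x y : ℕ × Fin (A + 1)}
    (hxy : M.Move x y) :
    m - M.next V y.1 y.2 ≤ (C + (m - M.next V x.1 x.2)) / M.γ x.2 y.2 := by
  obtain ⟨u, a⟩ := x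
  obtain ⟨w, b⟩ := y
  obtain ⟨hγ, hu, hw, h1, h2⟩ := hxy
  simp only at hγ hu hw h1 h2
  have hS := M.A_le_S
  have hval : ∀ (u' : ℕ) (a' : Fin (A + 1)) (i : Fin L), u' + A ≤ Q → u' ≤ u + a' → u + a' ≤ u' + S →
      V (clamp Q (u + a'), a', i) ≤ C + M.next V u' a' := by
    intro u' a' i k1 k2 k3
    have ha' := a'.2
    have hc : (clamp Q (u + a') : ℕ) = u + a' := clamp_val (by omega)
    have := M.bellman_le (lam := lam) (β := β) V (z := (clamp Q (u + a'), a', i))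
      (s := ⟨u + a' - u', by omega⟩) ⟨by simp only [hc]; omega, by simp only [hc]; omega⟩
    rw [hfix] at this
    simp only [hc] at this
    rw [show u + (a' : ℕ) - (u + a' - u') = u' by omega] at this
    have hn : 0 ≤ M.next V u' a' := M.le_next_of_le fun _ _ => h0 _
    nlinarith [hC (clamp Q (u + a'), a', i) ⟨u + a' - u', by omega⟩]
  -- If `b` packets arrive the kept queue is steered to `w`; otherwise it is held at `u`, where `m`
  -- bounds the continuation.
  have hsum : M.next V u a ≤
      ∑ a', M.γ a a' * (if a' = b then C + M.next V w b else C + m) := by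
    simp only [LinkModel.next]
    refine Finset.sum_le_sum fun a' _ => ?_
    have : M.γ a a' * (if a' = b then C + M.next V w b else C + m) =
        ∑ i, M.γ a a' * M.η i * (if a' = b then C + M.next V w b else C + m) := by
      rw [← Finset.sum_mul, ← Finset.mul_sum, M.η_sum, mul_one]
    simp only [LinkModel.next] at this
    rw [this]
    refine Finset.sum_le_sum fun i _ => mul_le_mul_of_nonneg_left ?_ (M.weight_nonneg _ _ _)
    split_ifs with hab
    · subst hab
      exact hval w a' i hw h1 h2
    · have := a'.2
      exact (hval u a' i hu (by omega) (by omega)).trans (by linarith [hm u a' hu])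
  have hsum2 : ∑ a', M.γ a a' * (if a' = b then C + M.next V w b else C + m) =
      C + m + M.γ a b * (M.next V w b - m) := by
    have : ∀ a', M.γ a a' * (if a' = b then C + M.next V w b else C + m) =
        M.γ a a' * (C + m) + (if a' = b then M.γ a a' * (M.next V w b - m) else 0) := by
      intro a'; split_ifs <;> ring
    simp_rw [this]
    rw [Finset.sum_add_distrib, ← Finset.sum_mul, M.γ_sum, one_mul]
    simp
  rw [le_div_iff₀ hγ]
  linarith

/-- The discounted value functions have bounded span, uniformly in the discount factor. -/
lemma exists_span (M : LinkModel Q A S L) (lam : ℝ) :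
    ∃ K, ∀ β ≤ 1, ∀ V, M.bellman lam β V = V → (∀ z, 0 ≤ V z) →
      ∀ u a u' a', u + A ≤ Q → u' + A ≤ Q → M.next V u a ≤ M.next V u' a' + K := by
  obtain ⟨C, hC0, hC⟩ := M.exists_stage_le lam
  have hA := M.A_le_Q
  have hpair : ∀ x y, Relation.ReflTransGen M.Move x y → ∃ K, ∀ β ≤ 1, ∀ V,
      M.bellman lam β V = V → (∀ z, 0 ≤ V z) → ∀ m, (∀ u a, u + A ≤ Q → M.next V u a ≤ m) →
      m ≤ M.next V x.1 x.2 → m - M.next V y.1 y.2 ≤ K := by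
    intro x y hxy
    induction hxy with
    | refl => exact ⟨0, fun _ _ _ _ _ _ _ h => by linarith⟩
    | @tail y z _ hyz ih =>
      obtain ⟨K, hK⟩ := ih
      refine ⟨(C + K) / M.γ y.2 z.2, fun β hβ V hV h0 m hm hx => ?_⟩
      refine (deficit_step hC hβ hV h0 hm hyz).trans ?_
      exact div_le_div_of_nonneg_right (by linarith [hK β hβ V hV h0 m hm hx]) hyz.1.le
  -- Finitely many pairs make the bound uniform. The source of the path will be a maximizer of
  -- `M.next V`, where `m` is attained.
  let Y := Fin (Q - A + 1) × Fin (A + 1)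
  have hY : ∀ x : Y, (x.1 : ℕ) + A ≤ Q := fun x => by have := x.1.2; omega
  have hK : ∀ p : Y × Y, ∃ K, ∀ β ≤ 1, ∀ V,
      M.bellman lam β V = V → (∀ z, 0 ≤ V z) → ∀ m, (∀ u a, u + A ≤ Q → M.next V u a ≤ m) →
      m ≤ M.next V p.1.1 p.1.2 → m - M.next V p.2.1 p.2.2 ≤ K := fun p =>
    hpair _ _ (M.reach (hY p.1) (hY p.2) p.1.2 p.2.2)
  choose K hK using hK
  obtain ⟨B, hB⟩ := exists_abs_le K
  refine ⟨B, fun β hβ V hV h0 u a u' a' hu hu' => ?_⟩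
  obtain ⟨x, hx⟩ := Finite.exists_max fun x : Y => M.next V x.1 x.2
  have hmax : ∀ u a, u + A ≤ Q → M.next V u a ≤ M.next V x.1 x.2 := fun u a hu =>
    hx (⟨u, by omega⟩, a)
  have h1 := hK (x, (⟨u', by omega⟩, a')) β hβ V hV h0 _ hmax le_rfl
  have h2 := (le_abs_self _).trans (hB (x, (⟨u', by omega⟩, a')))
  have h3 := hmax u a hu
  simp only at h1
  linarith

/-- One fixed ultrafilter gives limits of the gains and of all relative values at once, without
subsequences. -/
lemma exists_tendsto_hyperfilter {b : ℕ → ℝ} {K : ℝ} (h : ∀ n, |b n| ≤ K) :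
    ∃ l, Tendsto b (hyperfilter ℕ) (𝓝 l) := by
  obtain ⟨l, -, hl⟩ := (isCompact_Icc (a := -K) (b := K)).ultrafilter_le_nhds
    ((hyperfilter ℕ).map b) (by
      rw [le_principal_iff, Ultrafilter.mem_coe, Ultrafilter.mem_map]
      exact Filter.mem_of_superset Filter.univ_mem fun n _ => abs_le.1 (h n))
  exact ⟨l, hl⟩

/-- The average-cost Bellman equation, with gain `g` and relative value function `V`. -/
structure IsBellman (M : LinkModel Q A S L) (lam g : ℝ) (V : State Q A L → ℝ) : Prop where
  eq : ∀ z, g + V z = M.bellman lam 1 V z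
  convex : ConvexQueue V

/-- Vanishing discount: the average-cost Bellman equation is solvable. -/
lemma exists_isBellman (M : LinkModel Q A S L) {lam : ℝ} (hl : 0 ≤ lam) :
    ∃ g V, M.IsBellman lam g V := by
  have hA := M.A_le_Q
  obtain ⟨K, hK⟩ := M.exists_span lam
  obtain ⟨C, hC0, hC⟩ := M.exists_stage_le lam
  set β : ℕ → ℝ := fun n => 1 - 1 / ((n : ℝ) + 1) with hβdef
  have hpos : ∀ n : ℕ, 0 < 1 / ((n : ℝ) + 1) := fun n => Nat.one_div_pos_of_nat
  have hβ1 : ∀ n, β n < 1 := fun n => by simp only [hβdef]; linarith [hpos n]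
  have hβ0 : ∀ n, 0 ≤ β n := fun n => by
    simp only [hβdef, sub_nonneg]
    rw [div_le_one (by positivity)]
    linarith [Nat.cast_nonneg (α := ℝ) n]
  choose V hfix h0 hconv using fun n => M.exists_discounted hl (hβ0 n) (hβ1 n)
  set v₀ : ℕ → ℝ := fun n => M.next (V n) 0 0 with hv₀
  have hv₀0 : ∀ n, 0 ≤ v₀ n := fun n => M.le_next_of_le fun _ _ => h0 n _
  have hspan : ∀ n u a, u + A ≤ Q → |M.next (V n) u a - v₀ n| ≤ K := by
    intro n u a hu
    have h1 := hK _ (hβ1 n).le _ (hfix n) (h0 n) u a 0 0 hu (by omega)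
    have h2 := hK _ (hβ1 n).le _ (hfix n) (h0 n) 0 0 u a (by omega) hu
    rw [abs_le]
    constructor <;> simp only [hv₀] <;> linarith
  -- Starting from an empty kept queue and sending all arrivals costs at most `C` and empties it
  -- again, so `v₀ n` is bounded in terms of itself.
  have hgain : ∀ n, (1 - β n) * v₀ n ≤ C + K := by
    intro n
    have : v₀ n ≤ C + (β n * v₀ n + K) := by
      refine M.next_le_of_le fun a' i => ?_
      have hc : (clamp Q (0 + a') : ℕ) = a' := by
        rw [clamp_val (by have := a'.2; omega), zero_add]
      have ha' := a'.2
      have hS := M.A_le_S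
      have := M.bellman_le (lam := lam) (β := β n) (V n) (z := (clamp Q (0 + a'), a', i))
        (s := ⟨a', by omega⟩) ⟨by simp only [hc]; omega, by simp only [hc]; omega⟩
      rw [hfix] at this
      simp only [hc, Nat.sub_self] at this
      have h2 := (abs_le.1 (hspan n 0 a' (by omega))).2
      have h3 : β n * (M.next (V n) 0 a' - v₀ n) ≤ K := by
        have hK0 : 0 ≤ K := (abs_nonneg _).trans (hspan n 0 a' (by omega))
        nlinarith [hβ0 n, hβ1 n]
      have := hC (clamp Q (0 + a'), a', i) ⟨a', by omega⟩
      linarith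
    linarith
  -- Subtracting the reference value leaves a discounted equation whose terms remain bounded as the
  -- discount vanishes.
  have heq : ∀ n z, (1 - β n) * v₀ n + (V n z - v₀ n) =
      M.bellman lam (β n) (V n - fun _ => v₀ n) z := by
    intro n z
    have hsub : ∀ u a, M.next (V n - fun _ => v₀ n) u a = M.next (V n) u a - v₀ n := by
      intro u a
      have := M.next_add (V n - fun _ => v₀ n) (fun _ => v₀ n) u a
      rw [sub_add_cancel, next_const] at this
      linarith
    apply le_antisymm
    · obtain ⟨s, hs, e⟩ := M.exists_bellman_eq lam (β n) (V n - fun _ => v₀ n) z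
      have := M.bellman_le (lam := lam) (β := β n) (V n) hs
      rw [hfix] at this
      rw [e, hsub]
      linarith
    · obtain ⟨s, hs, e⟩ := M.exists_bellman_eq lam (β n) (V n) z
      have := M.bellman_le (lam := lam) (β := β n) (V n - fun _ => v₀ n) hs
      rw [hsub] at this
      rw [hfix] at e
      linarith
  have hbound : ∀ n z, |V n z - v₀ n| ≤ C + K + (C + K) := by
    intro n z
    obtain ⟨s, hs, e⟩ := M.exists_bellman_eq lam (β n) (V n) z
    rw [hfix] at e
    have h1 := abs_le.1 (hspan n (z.1 - s) z.2.1 (by have := hs.1; have := hs.2; omega))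
    have hK0 : 0 ≤ K := (abs_nonneg _).trans (hspan n 0 0 (by omega))
    have h2 := hC z s
    have h3 := M.stage_nonneg hl z s
    have h4 := hgain n
    have h5 : β n * (M.next (V n) (z.1 - s) z.2.1 - v₀ n) ≤ K := by nlinarith [hβ0 n, hβ1 n]
    have h6 : -K ≤ β n * (M.next (V n) (z.1 - s) z.2.1 - v₀ n) := by nlinarith [hβ0 n, hβ1 n]
    have h7 : 0 ≤ (1 - β n) * v₀ n := mul_nonneg (by linarith [hβ1 n]) (hv₀0 n)
    rw [abs_le]
    constructor <;> linarith
  have hbg : ∀ n, |(1 - β n) * v₀ n| ≤ C + K := fun n => by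
    rw [abs_of_nonneg (mul_nonneg (by linarith [hβ1 n]) (hv₀0 n))]; exact hgain n
  obtain ⟨g, hg⟩ := exists_tendsto_hyperfilter hbg
  choose W hW using fun z => exists_tendsto_hyperfilter fun n => hbound n z
  have hβlim : Tendsto β (hyperfilter ℕ) (𝓝 1) := by
    have : Tendsto β atTop (𝓝 (1 - 0)) :=
      tendsto_const_nhds.sub tendsto_one_div_add_atTop_nhds_zero_nat
    rw [sub_zero] at this
    exact this.mono_left Nat.hyperfilter_le_atTop
  refine ⟨g, W, fun z => ?_, fun a i q hq => ?_⟩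
  · have h1 := M.tendsto_bellman lam (V := fun n => V n - fun _ => v₀ n) hβlim hW z
    refine tendsto_nhds_unique (hg.add (hW z)) (h1.congr fun n => ?_)
    exact (heq n z).symm
  · refine le_of_tendsto_of_tendsto' ((hW _).const_mul 2) ((hW _).add (hW _)) fun n => ?_
    have := hconv n a i q hq
    simp only at this
    linarith

end LinkModel

/-! ### Exchange arguments and the lattice of rules -/

namespace LinkModel

open Matrix

variable {Q A S L : ℕ}

/-- The power saved by a better channel does not decrease with the rate. -/
def PowerSubmodular (M : LinkModel Q A S L) : Prop :=
  ∀ i j : Fin L, i < j → ∀ s s' : ℕ, s < s' → s' ≤ S →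
    M.P (M.h j) s' - M.P (M.h j) s ≤ M.P (M.h i) s' - M.P (M.h i) s

/-- The rate `s` attains the minimum in the Bellman operator. -/
def IsOpt (M : LinkModel Q A S L) (lam : ℝ) (V : State Q A L → ℝ) (z : State Q A L)
    (s : Fin (S + 1)) : Prop :=
  Feasible Q A z.1 s ∧ M.bellman lam 1 V z = M.stage lam z s + M.next V (z.1 - s) z.2.1

variable {M : LinkModel Q A S L} {lam : ℝ} {V : State Q A L → ℝ}

/-- Each rate minimizes its own cost, so a feasible pair of no greater total cost must attain both
minima. The exchange arguments below all end here. -/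
lemma isOpt_of_add_le {z₁ z₂ : State Q A L} {s₁ s₂ t₁ t₂ : Fin (S + 1)}
    (h₁ : M.IsOpt lam V z₁ s₁) (h₂ : M.IsOpt lam V z₂ s₂)
    (f₁ : Feasible Q A z₁.1 t₁) (f₂ : Feasible Q A z₂.1 t₂)
    (h : M.stage lam z₁ t₁ + M.next V (z₁.1 - t₁) z₁.2.1 +
        (M.stage lam z₂ t₂ + M.next V (z₂.1 - t₂) z₂.2.1) ≤
      M.stage lam z₁ s₁ + M.next V (z₁.1 - s₁) z₁.2.1 +
        (M.stage lam z₂ s₂ + M.next V (z₂.1 - s₂) z₂.2.1)) :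
    M.IsOpt lam V z₁ t₁ ∧ M.IsOpt lam V z₂ t₂ := by
  have b₁ := M.bellman_le (lam := lam) (β := 1) V f₁
  have b₂ := M.bellman_le (lam := lam) (β := 1) V f₂
  have e₁ := h₁.2
  have e₂ := h₂.2
  rw [one_mul] at b₁ b₂
  exact ⟨⟨f₁, by linarith⟩, ⟨f₂, by linarith⟩⟩

lemma exists_isOpt (M : LinkModel Q A S L) (lam : ℝ) (V : State Q A L → ℝ) (z : State Q A L) :
    ∃ s, M.IsOpt lam V z s := by
  obtain ⟨s, hs, e⟩ := M.exists_bellman_eq lam 1 V z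
  exact ⟨s, hs, by rw [e, one_mul]⟩

/-- Trading the rates preserves the total power and moves the kept parts inward, where convexity of
the continuation applies. -/
lemma IsOpt.swap (hV : ConvexQueue V) {q q' : Fin (Q + 1)}
    {a : Fin (A + 1)} {i : Fin L} (hq : (q' : ℕ) = q + 1) {s₁ s₂ : Fin (S + 1)}
    (h₁ : M.IsOpt lam V (q, a, i) s₁) (h₂ : M.IsOpt lam V (q', a, i) s₂) (h : s₂ < s₁) :
    M.IsOpt lam V (q, a, i) s₂ ∧ M.IsOpt lam V (q', a, i) s₁ := by
  obtain ⟨⟨f₁, g₁⟩, -⟩ := id h₁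
  obtain ⟨⟨f₂, g₂⟩, -⟩ := id h₂
  simp only at f₁ g₁ f₂ g₂
  have hA := M.A_le_Q
  have hlt : (s₂ : ℕ) < s₁ := h
  refine isOpt_of_add_le h₁ h₂ ⟨by simp only; omega, by simp only; omega⟩
    ⟨by simp only; omega, by simp only; omega⟩ ?_
  have := (hV.next (M := M) a).exchange_kept hlt g₁ (by omega)
  simp only [stage, power, hq] at this ⊢
  linarith

/-- The new rates trade the kept parts and lie between the old rates, so convexity of the power
applies. Hence no jump of two or more is forced. -/
lemma IsOpt.shift (hl : 0 ≤ lam) {q q' : Fin (Q + 1)}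
    {a : Fin (A + 1)} {i : Fin L} (hq : (q' : ℕ) = q + 1) {s₁ s₂ : Fin (S + 1)}
    (h₁ : M.IsOpt lam V (q, a, i) s₁) (h₂ : M.IsOpt lam V (q', a, i) s₂)
    (h : (s₁ : ℕ) + 1 < s₂) {t₁ t₂ : Fin (S + 1)} (ht₁ : (t₁ : ℕ) + 1 = s₂)
    (ht₂ : (t₂ : ℕ) = s₁ + 1) :
    M.IsOpt lam V (q, a, i) t₁ ∧ M.IsOpt lam V (q', a, i) t₂ := by
  obtain ⟨⟨f₁, g₁⟩, -⟩ := id h₁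
  obtain ⟨⟨f₂, g₂⟩, -⟩ := id h₂
  simp only at f₁ g₁ f₂ g₂
  refine isOpt_of_add_le h₁ h₂ ⟨by simp only; omega, by simp only; omega⟩
    ⟨by simp only; omega, by simp only; omega⟩ ?_
  have := (M.convex_power hl i).exchange (x := s₁) (y := s₂) (by omega) (by omega)
  have e₁ : (q : ℕ) - t₁ = q' - s₂ := by omega
  have e₂ : (q' : ℕ) - (s₁ + 1) = q - s₁ := by omega
  have e₃ : (s₂ : ℕ) - 1 = t₁ := by omega
  simp only [stage, power, e₁, ht₂, e₂, e₃] at this ⊢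
  linarith

/-- The continuation ignores the current channel, so trading the rates affects only the power, where
submodularity decides. -/
lemma IsOpt.channel (hP : M.PowerSubmodular) (hl : 0 ≤ lam) {q : Fin (Q + 1)} {a : Fin (A + 1)}
    {i j : Fin L} (hij : i < j) {s₁ s₂ : Fin (S + 1)} (h₁ : M.IsOpt lam V (q, a, i) s₁)
    (h₂ : M.IsOpt lam V (q, a, j) s₂) (h : s₂ < s₁) :
    M.IsOpt lam V (q, a, i) s₂ ∧ M.IsOpt lam V (q, a, j) s₁ := by
  refine isOpt_of_add_le h₁ h₂ h₂.1 h₁.1 ?_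
  have := mul_le_mul_of_nonneg_left (hP i j hij s₂ s₁ h (by omega)) hl
  simp only [stage, power]
  linarith

/-- Convexity of the power and of the continuation lets both rates move inward by one. The gap
shrinks by two, hence the strong induction. -/
lemma IsOpt.inner (hV : ConvexQueue V) (hl : 0 ≤ lam)
    {z : State Q A L} : ∀ (n : ℕ) {s₁ s₂ s : Fin (S + 1)}, (s₂ : ℕ) ≤ s₁ + n →
    M.IsOpt lam V z s₁ → M.IsOpt lam V z s₂ → s₁ ≤ s → s ≤ s₂ → M.IsOpt lam V z s := by
  intro n
  induction n using Nat.strong_induction_on with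
  | _ n ih =>
    intro s₁ s₂ s hn h₁ h₂ hs₁ hs₂
    rcases eq_or_lt_of_le hs₁ with rfl | hlt₁
    · exact h₁
    rcases eq_or_lt_of_le hs₂ with rfl | hlt₂
    · exact h₂
    have k₁ : (s₁ : ℕ) < s := hlt₁
    have k₂ : (s : ℕ) < s₂ := hlt₂
    obtain ⟨q, a, i⟩ := z
    obtain ⟨⟨f₁, g₁⟩, -⟩ := id h₁
    obtain ⟨⟨f₂, g₂⟩, -⟩ := id h₂
    simp only at f₁ g₁ f₂ g₂
    have hA := M.A_le_Q
    have := isOpt_of_add_le h₁ h₂ (t₁ := ⟨s₁ + 1, by omega⟩) (t₂ := ⟨s₂ - 1, by omega⟩)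
      ⟨by simp only; omega, by simp only; omega⟩ ⟨by simp only; omega, by simp only; omega⟩ (by
        have e1 := (M.convex_power hl i).exchange (x := s₁) (y := s₂) (by omega) (by omega)
        have e2 := (hV.next (M := M) a).exchange (x := q - s₂) (y := q - s₁) (by omega) (by omega)
        rw [show (q : ℕ) - s₂ + 1 = q - (s₂ - 1) by omega,
          show (q : ℕ) - s₁ - 1 = q - (s₁ + 1) by omega] at e2
        simp only [stage, power] at e1 e2 ⊢
        linarith)
    exact ih (n - 2) (by omega) (by simp only; omega) this.1 this.2
      (by rw [Fin.le_def]; simp only; omega) (by rw [Fin.le_def]; simp only; omega)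

/-- Apart from feasibility, every condition has the form `f z ≤ f z' + c`, which pointwise maxima
and minima preserve. -/
lemma IsRule.sup {f f' : State Q A L → Fin (S + 1)} (hf : IsRule f) (hf' : IsRule f') :
    IsRule (f ⊔ f') where
  feasible z := by
    rcases max_choice (f z) (f' z) with h | h
    · simpa only [Pi.sup_apply, h] using hf.feasible z
    · simpa only [Pi.sup_apply, h] using hf'.feasible z
  mono q q' a i hq := by
    have := hf.mono q q' a i hq
    have := hf'.mono q q' a i hq
    simp only [Pi.sup_apply, Fin.coe_max]
    omega
  lip q q' a i hq := by
    have := hf.lip q q' a i hq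
    have := hf'.lip q q' a i hq
    simp only [Pi.sup_apply, Fin.coe_max]
    omega
  channel q a i j hij := by
    have := hf.channel q a i j hij
    have := hf'.channel q a i j hij
    simp only [Pi.sup_apply, Fin.coe_max]
    omega

lemma IsRule.inf {f f' : State Q A L → Fin (S + 1)} (hf : IsRule f) (hf' : IsRule f') :
    IsRule (f ⊓ f') where
  feasible z := by
    rcases min_choice (f z) (f' z) with h | h
    · simpa only [Pi.inf_apply, h] using hf.feasible z
    · simpa only [Pi.inf_apply, h] using hf'.feasible z
  mono q q' a i hq := by
    have := hf.mono q q' a i hq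
    have := hf'.mono q q' a i hq
    simp only [Pi.inf_apply, Fin.coe_min]
    omega
  lip q q' a i hq := by
    have := hf.lip q q' a i hq
    have := hf'.lip q q' a i hq
    simp only [Pi.inf_apply, Fin.coe_min]
    omega
  channel q a i j hij := by
    have := hf.channel q a i j hij
    have := hf'.channel q a i j hij
    simp only [Pi.inf_apply, Fin.coe_min]
    omega

/-- The least optimal rates form a rule. -/
lemma exists_least_rule (hP : M.PowerSubmodular) (hl : 0 ≤ lam) (hV : ConvexQueue V) :
    ∃ f, IsRule f ∧ (∀ z, M.IsOpt lam V z (f z)) ∧ ∀ z s, M.IsOpt lam V z s → f z ≤ s := by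
  classical
  have hmin : ∀ z, ∃ s, M.IsOpt lam V z s ∧ ∀ t, M.IsOpt lam V z t → s ≤ t := by
    intro z
    obtain ⟨s₀, hs₀⟩ := M.exists_isOpt lam V z
    obtain ⟨s, hs, h⟩ := Finset.exists_min_image (Finset.univ.filter (M.IsOpt lam V z)) id
      ⟨s₀, by simpa using hs₀⟩
    exact ⟨s, by simpa using hs, fun t ht => h t (by simpa using ht)⟩
  choose f hf hle using hmin
  refine ⟨f, ⟨fun z => (hf z).1, fun q q' a i hq => ?_, fun q q' a i hq => ?_,
    fun q a i j hij => ?_⟩, hf, hle⟩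
  · by_contra hlt
    exact hlt (hle _ _ (IsOpt.swap hV hq (hf _) (hf _) (not_le.1 hlt)).1)
  · by_contra hlt
    have b := (f (q', a, i)).2
    have := hle _ _ (IsOpt.shift hl hq (hf (q, a, i)) (hf (q', a, i)) (by omega)
      (t₁ := ⟨f (q', a, i) - 1, by omega⟩) (t₂ := ⟨f (q, a, i) + 1, by omega⟩)
      (by simp only; omega) rfl).2
    exact hlt this
  · by_contra hlt
    exact hlt (hle _ _ (IsOpt.channel hP hl hij (hf _) (hf _) (not_le.1 hlt)).1)

/-- The greatest optimal rates form a rule. -/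
lemma exists_greatest_rule (hP : M.PowerSubmodular) (hl : 0 ≤ lam) (hV : ConvexQueue V) :
    ∃ f, IsRule f ∧ (∀ z, M.IsOpt lam V z (f z)) ∧ ∀ z s, M.IsOpt lam V z s → s ≤ f z := by
  classical
  have hmax : ∀ z, ∃ s, M.IsOpt lam V z s ∧ ∀ t, M.IsOpt lam V z t → t ≤ s := by
    intro z
    obtain ⟨s₀, hs₀⟩ := M.exists_isOpt lam V z
    obtain ⟨s, hs, h⟩ := Finset.exists_max_image (Finset.univ.filter (M.IsOpt lam V z)) id
      ⟨s₀, by simpa using hs₀⟩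
    exact ⟨s, by simpa using hs, fun t ht => h t (by simpa using ht)⟩
  choose f hf hle using hmax
  refine ⟨f, ⟨fun z => (hf z).1, fun q q' a i hq => ?_, fun q q' a i hq => ?_,
    fun q a i j hij => ?_⟩, hf, hle⟩
  · by_contra hlt
    exact hlt (hle _ _ (IsOpt.swap hV hq (hf _) (hf _) (not_le.1 hlt)).2)
  · by_contra hlt
    have b := (f (q', a, i)).2
    have := hle _ _ (IsOpt.shift hl hq (hf (q, a, i)) (hf (q', a, i)) (by omega)
      (t₁ := ⟨f (q', a, i) - 1, by omega⟩) (t₂ := ⟨f (q, a, i) + 1, by omega⟩)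
      (by simp only; omega) rfl).1
    have this : (f (q', a, i) : ℕ) - 1 ≤ f (q, a, i) := this
    omega
  · by_contra hlt
    exact hlt (hle _ _ (IsOpt.channel hP hl hij (hf _) (hf _) (not_le.1 hlt)).2)

/-- A rule can be made optimal in every state without changing it where it is optimal. -/
lemma exists_clip (hP : M.PowerSubmodular) (hl : 0 ≤ lam) (hV : ConvexQueue V)
    {f : State Q A L → Fin (S + 1)} (hf : IsRule f) :
    ∃ k, IsRule k ∧ (∀ z, M.IsOpt lam V z (k z)) ∧ ∀ z, M.IsOpt lam V z (f z) → k z = f z := by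
  obtain ⟨f₁, r₁, o₁, l₁⟩ := exists_least_rule hP hl hV
  obtain ⟨f₂, r₂, o₂, l₂⟩ := exists_greatest_rule hP hl hV
  -- The median of `f` and the two extreme optimal rules.
  refine ⟨f₁ ⊔ (f ⊓ f₂), r₁.sup (hf.inf r₂), fun z => ?_, fun z hz => ?_⟩
  · exact IsOpt.inner hV hl S (by omega) (o₁ z) (o₂ z) le_sup_left
      (sup_le (l₁ z _ (o₂ z)) inf_le_right)
  · have h₁ := l₁ z _ hz
    have h₂ := l₂ z _ hz
    simp only [Pi.sup_apply, Pi.inf_apply, inf_eq_left.2 h₂, sup_eq_right.2 h₁]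

/-- One unit step inside the rules from `f` towards `f'`. -/
lemma exists_update_rule {f f' : State Q A L → Fin (S + 1)} (hf : IsRule f) (hf' : IsRule f')
    (hle : f ≤ f') (hne : f ≠ f') : ∃ k z₀, IsRule k ∧ f ≤ k ∧ k ≤ f' ∧
      (k z₀ : ℕ) = f z₀ + 1 ∧ ∀ z, z ≠ z₀ → k z = f z := by
  classical
  set D := Finset.univ.filter fun z => f z < f' z with hD
  have hDne : D.Nonempty := by
    obtain ⟨z, hz⟩ := Function.ne_iff.1 hne
    exact ⟨z, by simpa [hD] using lt_of_le_of_ne (hle z) hz⟩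
  have hmem : ∀ z, z ∈ D ↔ (f z : ℕ) < f' z := by
    intro z
    rw [hD, Finset.mem_filter]
    exact ⟨fun h => h.2, fun h => ⟨Finset.mem_univ _, h⟩⟩
  -- Least rate first, then longest queue, then best channel. If raising `z₀` broke a condition, the
  -- same condition for `f'` would put an earlier state into `D`: a longer queue for `mono`, a
  -- smaller rate for `lip`, a better channel for `channel`. Arrivals need no order, since no
  -- condition compares them.
  obtain ⟨z₀, hz₀, hmin⟩ := Finset.exists_min_image D
    (fun z => toLex ((f z : ℕ), toLex (OrderDual.toDual z.1, OrderDual.toDual z.2.2))) hDne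
  have hmin' : ∀ z ∈ D, ¬ ((f z : ℕ) < f z₀ ∨ ((f z : ℕ) = f z₀ ∧
      (z₀.1 < z.1 ∨ (z.1 = z₀.1 ∧ z₀.2.2 < z.2.2)))) := by
    intro z hz hcon
    refine not_lt.2 (hmin z hz) ?_
    rw [Prod.Lex.toLex_lt_toLex]
    rcases hcon with h | ⟨h1, h2⟩
    · exact Or.inl h
    · refine Or.inr ⟨h1, ?_⟩
      simp only
      rw [Prod.Lex.toLex_lt_toLex]
      rcases h2 with h | ⟨h, h'⟩
      · exact Or.inl h
      · exact Or.inr ⟨by simp [h], h'⟩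
  have hlt := (hmem z₀).1 hz₀
  have hb := (f' z₀).2
  obtain ⟨q₀, a₀, i₀⟩ := z₀
  set z₀ : State Q A L := (q₀, a₀, i₀) with hz₀d
  set k := Function.update f z₀ ⟨f z₀ + 1, by omega⟩ with hk
  have hk₀ : (k z₀ : ℕ) = f z₀ + 1 := by simp [hk]
  have hk₁ : ∀ z, z ≠ z₀ → k z = f z := fun z hz => by simp [hk, hz]
  have hkcases : ∀ z, (z = z₀ ∧ (k z : ℕ) = f z + 1) ∨ (z ≠ z₀ ∧ (k z : ℕ) = f z) := by
    intro z
    by_cases h : z = z₀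
    · exact Or.inl ⟨h, by rw [h, hk₀]⟩
    · exact Or.inr ⟨h, by rw [hk₁ z h]⟩
  refine ⟨k, z₀, ⟨fun z => ?_, fun q q' a i hq => ?_, fun q q' a i hq => ?_, fun q a i j hij => ?_⟩,
    fun z => ?_, fun z => ?_, hk₀, hk₁⟩
  · rcases hkcases z with ⟨rfl, h⟩ | ⟨h, -⟩
    · obtain ⟨g₁, g₂⟩ := hf.feasible z₀
      obtain ⟨g₃, g₄⟩ := hf'.feasible z₀
      exact ⟨by omega, by omega⟩
    · rw [hk₁ z h]; exact hf.feasible z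
  · have h1 := hf.mono q q' a i hq
    have h2 := hf'.mono q q' a i hq
    rcases hkcases (q, a, i) with ⟨e, h⟩ | ⟨-, h⟩ <;>
      rcases hkcases (q', a, i) with ⟨e', h'⟩ | ⟨-, h'⟩ <;> try omega
    by_contra hcon
    rw [e] at h h1 h2 hcon
    refine hmin' (q', a, i) ((hmem _).2 (by omega)) (Or.inr ⟨by omega, Or.inl ?_⟩)
    have : q = q₀ := congrArg Prod.fst e
    rw [Fin.lt_def]
    simp only [hz₀d, ← this]
    omega
  · have h1 := hf.lip q q' a i hq
    have h2 := hf'.lip q q' a i hq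
    rcases hkcases (q, a, i) with ⟨e, h⟩ | ⟨-, h⟩ <;>
      rcases hkcases (q', a, i) with ⟨e', h'⟩ | ⟨-, h'⟩ <;> try omega
    by_contra hcon
    rw [e'] at h' h1 h2 hcon
    exact hmin' (q, a, i) ((hmem _).2 (by omega)) (Or.inl (by omega))
  · have h1 := hf.channel q a i j hij
    have h2 := hf'.channel q a i j hij
    rcases hkcases (q, a, i) with ⟨e, h⟩ | ⟨-, h⟩ <;>
      rcases hkcases (q, a, j) with ⟨e', h'⟩ | ⟨-, h'⟩ <;> try omega
    by_contra hcon
    rw [e] at h h1 h2 hcon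
    refine hmin' (q, a, j) ((hmem _).2 (by omega)) (Or.inr ⟨by omega, Or.inr ?_⟩)
    have hq : q = q₀ := congrArg Prod.fst e
    have hi : i = i₀ := congrArg (fun z => z.2.2) e
    exact ⟨hq, by simpa only [hz₀d, ← hi] using hij⟩
  · rcases hkcases z with ⟨-, h⟩ | ⟨-, h⟩ <;> rw [Fin.le_def] <;> omega
  · have := hle z
    rw [Fin.le_def] at this ⊢
    rcases hkcases z with ⟨rfl, h⟩ | ⟨-, h⟩ <;> omega

end LinkModel

/-! ### Lagrangian bounds and the multiplier -/

namespace LinkModel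

open Matrix

variable {Q A S L : ℕ} {M : LinkModel Q A S L} {lam g : ℝ} {V : State Q A L → ℝ}

/-- The delay cost of a state. -/
noncomputable def delay (M : LinkModel Q A S L) (z : State Q A L) : ℝ :=
  1 / M.α * ((z.1 : ℕ) : ℝ)

lemma policyCost_stage {F : State Q A L → Fin (S + 1) → ℝ} (hF : IsPolicy F) :
    policyCost F (M.stage lam) = M.delay + lam • policyCost F M.power := by
  funext z
  simp only [policyCost, stage, delay, mul_add, Finset.sum_add_distrib, Pi.add_apply,
    Pi.smul_apply, smul_eq_mul, ← Finset.sum_mul, hF.sum_eq_one, one_mul, Finset.mul_sum]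
  congr 1
  exact Finset.sum_congr rfl fun _ _ => by ring

lemma IsBellman.le_policyCost (hB : M.IsBellman lam g V) {F : State Q A L → Fin (S + 1) → ℝ}
    (hF : IsPolicy F) (z : State Q A L) :
    g + V z ≤ policyCost F (M.stage lam) z + (M.transition F *ᵥ V) z := by
  rw [transition_mulVec hF, policyCost, ← Finset.sum_add_distrib, ← one_mul (g + V z),
    ← hF.sum_eq_one z, Finset.sum_mul]
  refine Finset.sum_le_sum fun s _ => ?_
  by_cases hs : Feasible Q A z.1 s
  · rw [← mul_add, hB.eq]
    have := M.bellman_le (lam := lam) (β := 1) V hs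
    rw [one_mul] at this
    exact mul_le_mul_of_nonneg_left this (hF.nonneg z s)
  · simp [hF.eq_zero z s hs]

lemma IsBellman.eq_policyCost (hB : M.IsBellman lam g V) {F : State Q A L → Fin (S + 1) → ℝ}
    (hF : IsPolicy F) {z : State Q A L} (hopt : ∀ s, F z s ≠ 0 → M.IsOpt lam V z s) :
    g + V z = policyCost F (M.stage lam) z + (M.transition F *ᵥ V) z := by
  rw [transition_mulVec hF, policyCost, ← Finset.sum_add_distrib, ← one_mul (g + V z),
    ← hF.sum_eq_one z, Finset.sum_mul]
  refine Finset.sum_congr rfl fun s _ => ?_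
  by_cases hs : F z s = 0
  · simp [hs]
  · rw [← mul_add, hB.eq, (hopt s hs).2]

lemma IsBellman.le_stationary (hB : M.IsBellman lam g V) {F : State Q A L → Fin (S + 1) → ℝ}
    (hF : IsPolicy F) {π : State Q A L → ℝ} (hπ : IsStationaryLaw (M.transition F) π) :
    g ≤ π ⬝ᵥ M.delay + lam * (π ⬝ᵥ policyCost F M.power) := by
  have h : π ⬝ᵥ ((fun _ => g) + V) ≤
      π ⬝ᵥ (policyCost F (M.stage lam) + M.transition F *ᵥ V) :=
    Finset.sum_le_sum fun z _ => mul_le_mul_of_nonneg_left (hB.le_policyCost hF z) (hπ.nonneg z)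
  rw [dotProduct_add, dotProduct_add, hπ.dotProduct_mulVec, hπ.dotProduct_const,
    policyCost_stage hF, dotProduct_add, dotProduct_smul, smul_eq_mul] at h
  linarith

lemma IsBellman.eq_stationary (hB : M.IsBellman lam g V) {F : State Q A L → Fin (S + 1) → ℝ}
    (hF : IsPolicy F) (hopt : ∀ z s, F z s ≠ 0 → M.IsOpt lam V z s) {π : State Q A L → ℝ}
    (hπ : IsStationaryLaw (M.transition F) π) :
    g = π ⬝ᵥ M.delay + lam * (π ⬝ᵥ policyCost F M.power) := by
  have h : π ⬝ᵥ ((fun _ => g) + V) =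
      π ⬝ᵥ (policyCost F (M.stage lam) + M.transition F *ᵥ V) :=
    Finset.sum_congr rfl fun z _ => congrArg (π z * ·) (hB.eq_policyCost hF (hopt z))
  rw [dotProduct_add, dotProduct_add, hπ.dotProduct_mulVec, hπ.dotProduct_const,
    policyCost_stage hF, dotProduct_add, dotProduct_smul, smul_eq_mul] at h
  linarith

lemma pure_ne_zero {f : State Q A L → Fin (S + 1)} {z : State Q A L} {s : Fin (S + 1)}
    (h : pure f z s ≠ 0) : s = f z := by
  by_contra hne
  exact h (if_neg hne)

lemma policyCost_pure (f : State Q A L → Fin (S + 1)) (c : State Q A L → Fin (S + 1) → ℝ)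
    (z : State Q A L) : policyCost (pure f) c z = c z (f z) := sum_pure_mul f z (c z)

/-- A rule whose stationary cost equals the gain is optimal wherever it is recurrent. -/
lemma IsBellman.isOpt_of_stationary (hB : M.IsBellman lam g V) {f : State Q A L → Fin (S + 1)}
    (hf : ∀ z, Feasible Q A z.1 (f z)) {π : State Q A L → ℝ}
    (hπ : IsStationaryLaw (M.transition (pure f)) π)
    (h : π ⬝ᵥ M.delay + lam * (π ⬝ᵥ policyCost (pure f) M.power) = g) (z : State Q A L)
    (hz : π z ≠ 0) : M.IsOpt lam V z (f z) := by
  have hF := isPolicy_pure hf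
  have hle := hB.le_policyCost hF
  have hsum : π ⬝ᵥ ((fun _ => g) + V) =
      π ⬝ᵥ (policyCost (pure f) (M.stage lam) + M.transition (pure f) *ᵥ V) := by
    rw [dotProduct_add, dotProduct_add, hπ.dotProduct_mulVec, hπ.dotProduct_const,
      policyCost_stage hF, dotProduct_add, dotProduct_smul, smul_eq_mul]
    linarith
  -- The stationary means of both sides agree, so the pointwise inequality is an equality on the
  -- support.
  have := (Finset.sum_eq_sum_iff_of_le fun z _ =>
    mul_le_mul_of_nonneg_left (hle z) (hπ.nonneg z)).1 hsum z (Finset.mem_univ z)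
  have he := mul_left_cancel₀ hz this
  rw [policyCost_pure, transition_mulVec hF, sum_pure_mul f z fun s => M.next V (z.1 - s) z.2.1,
    hB.eq] at he
  exact ⟨hf z, he⟩

/-- Rows outside the support of `π` carry no weight in the balance equations. -/
lemma isStationaryLaw_congr {F F' : State Q A L → Fin (S + 1) → ℝ} {π : State Q A L → ℝ}
    (hπ : IsStationaryLaw (M.transition F) π) (h : ∀ z, π z ≠ 0 → F' z = F z) :
    IsStationaryLaw (M.transition F') π := by
  refine ⟨hπ.nonneg, hπ.sum_eq_one, ?_⟩
  conv_rhs => rw [← hπ.vecMul_eq]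
  funext y
  simp only [vecMul, dotProduct, transition]
  refine Finset.sum_congr rfl fun z _ => ?_
  by_cases hz : π z = 0
  · simp [hz]
  · rw [h z hz]

/-- The average power is `p`, from every initial state and under every stationary distribution. -/
def HasPower (M : LinkModel Q A S L) (F : State Q A L → Fin (S + 1) → ℝ) (p : ℝ) : Prop :=
  ∃ w, policyCost F M.power = (fun _ => p) + w - M.transition F *ᵥ w

lemma HasPower.dotProduct_eq {F : State Q A L → Fin (S + 1) → ℝ} {p : ℝ} (h : M.HasPower F p)
    {π : State Q A L → ℝ} (hπ : IsStationaryLaw (M.transition F) π) :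
    π ⬝ᵥ policyCost F M.power = p := by
  obtain ⟨w, hw⟩ := h
  rw [hw, dotProduct_sub, dotProduct_add, hπ.dotProduct_mulVec, hπ.dotProduct_const]
  ring

lemma HasPower.tendsto {F : State Q A L → Fin (S + 1) → ℝ} (hF : IsPolicy F) {p : ℝ}
    (h : M.HasPower F p) (z : State Q A L) : M.HasAvgPower F z p := by
  obtain ⟨w, hw⟩ := h
  have hT := transition_mem_rowStochastic (M := M) hF
  exact tendsto_cesaro_of_poisson hT (p := fun _ => p) (mulVec_const_of_mem_rowStochastic hT p) hw z

lemma IsRule.exists_hasPower {f : State Q A L → Fin (S + 1)} (M : LinkModel Q A S L)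
    (hf : IsRule f) : ∃ p, M.HasPower (pure f) p := by
  obtain ⟨p, w, h⟩ := exists_power_mix (M := M) le_rfl zero_le_one hf hf
  rw [mix_self] at h
  exact ⟨p, w, h⟩

lemma tendsto_delay_add {F : State Q A L → Fin (S + 1) → ℝ} (hF : IsPolicy F) (z : State Q A L)
    {d p : ℝ} (hd : M.HasAvgDelay F z d) (hp : M.HasAvgPower F z p) :
    Tendsto (cesaro (M.transition F) (policyCost F (M.stage lam)) z) atTop (𝓝 (d + lam * p)) := by
  refine (Tendsto.add hd (hp.const_mul lam)).congr fun N => ?_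
  rw [policyCost_stage hF, cesaro_add, cesaro_smul]
  rfl

/-- The Lagrangian lower bound on the delay and the power of an arbitrary policy. -/
lemma IsBellman.le_avg (hB : M.IsBellman lam g V) {F : State Q A L → Fin (S + 1) → ℝ}
    (hF : IsPolicy F) (z : State Q A L) {d p : ℝ} (hd : M.HasAvgDelay F z d)
    (hp : M.HasAvgPower F z p) : g ≤ d + lam * p :=
  le_of_tendsto_cesaro (transition_mem_rowStochastic hF) (hB.le_policyCost hF) z
    (tendsto_delay_add hF z hd hp)

/-- Sufficient conditions for optimality from every initial state. -/
lemma IsBellman.isOptimal (hB : M.IsBellman lam g V) (hl : 0 ≤ lam)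
    {F : State Q A L → Fin (S + 1) → ℝ} (hF : IsPolicy F)
    (hopt : ∀ z s, F z s ≠ 0 → M.IsOpt lam V z s) {p Pth : ℝ} (hp : M.HasPower F p)
    (hle : p ≤ Pth) (hcs : lam = 0 ∨ p = Pth) (z : State Q A L) : M.IsOptimal Pth F z := by
  have hT := transition_mem_rowStochastic (M := M) hF
  have hg : Tendsto (cesaro (M.transition F) (policyCost F (M.stage lam)) z) atTop (𝓝 g) := by
    refine tendsto_cesaro_of_poisson hT (p := fun _ => g) (w := V)
      (mulVec_const_of_mem_rowStochastic hT g) ?_ z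
    funext y
    have := hB.eq_policyCost hF (hopt y)
    simp only [Pi.add_apply, Pi.sub_apply]
    linarith
  have hpz := hp.tendsto hF z
  -- The Lagrangian and power averages converge, hence so does the delay.
  have hd : M.HasAvgDelay F z (g - lam * p) := by
    refine (Tendsto.sub hg (hpz.const_mul lam)).congr fun N => ?_
    rw [policyCost_stage hF, cesaro_add, cesaro_smul]
    exact add_sub_cancel_right _ _
  refine ⟨hF, _, _, hd, hpz, hle, fun F' hF' d' p' hd' hp' hle' => ?_⟩
  have h1 := hB.le_avg hF' z hd' hp'
  have h2 : lam * p' ≤ lam * p := by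
    rcases hcs with rfl | rfl
    · simp
    · exact mul_le_mul_of_nonneg_left hle' hl
  linarith

/-- The Lagrangian relaxation of a finite constrained problem is tight after mixing. -/
lemma exists_multiplier {ι : Type*} [Finite ι] (P D : ι → ℝ) {c : ℝ} (hc : ∃ i, P i ≤ c) :
    ∃ lam, 0 ≤ lam ∧ ∃ i, (∀ j, D i + lam * P i ≤ D j + lam * P j) ∧ P i ≤ c ∧
      (lam = 0 ∨ ∃ j, (∀ k, D j + lam * P j ≤ D k + lam * P k) ∧ c < P j) := by
  classical
  have := Fintype.ofFinite ι
  -- The multiplier at which `i` and `j` tie.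
  set cross : ι → ι → ℝ := fun i j => (D i - D j) / (P j - P i) with hcross
  set B := Finset.univ.filter fun j => c < P j with hBdef
  have hB : ∀ j, j ∈ B ↔ c < P j := by simp [hBdef]
  have hiff : ∀ i j lam, P i ≤ c → c < P j →
      (cross i j ≤ lam ↔ D i + lam * P i ≤ D j + lam * P j) := by
    intro i j lam hi hj
    rw [hcross, div_le_iff₀ (by linarith)]
    constructor <;> intro h <;> linarith
  -- For `i` within the budget, this is the least nonnegative multiplier at which nothing above the
  -- budget beats `i`.
  have hm : ∀ i, ∃ m, (m = 0 ∨ ∃ j, c < P j ∧ m = cross i j) ∧ 0 ≤ m ∧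
      ∀ j, c < P j → cross i j ≤ m := by
    intro i
    have hne : (insert 0 (B.image (cross i))).Nonempty := Finset.insert_nonempty _ _
    refine ⟨_, ?_, Finset.le_max' _ _ (Finset.mem_insert_self _ _), fun j hj =>
      Finset.le_max' (insert 0 (B.image (cross i))) _ (Finset.mem_insert_of_mem
        (Finset.mem_image_of_mem _ ((hB j).2 hj)))⟩
    have := Finset.max'_mem _ hne
    rw [Finset.mem_insert, Finset.mem_image] at this
    rcases this with h | ⟨j, hj, h⟩
    · exact Or.inl h
    · exact Or.inr ⟨j, (hB j).1 hj, h.symm⟩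
  choose m hm₁ hm₀ hm₂ using hm
  obtain ⟨i₀, hi₀⟩ := hc
  have hAne : (Finset.univ.filter fun i => P i ≤ c).Nonempty := ⟨i₀, by simpa using hi₀⟩
  obtain ⟨i₁, hi₁, hmin₁⟩ := Finset.exists_min_image _ m hAne
  obtain ⟨i, hi, hmin⟩ := Finset.exists_min_image _ (fun i => D i + m i₁ * P i) hAne
  simp only [Finset.mem_filter, Finset.mem_univ, true_and] at hi₁ hmin₁ hi hmin
  have hopt : ∀ j, D i + m i₁ * P i ≤ D j + m i₁ * P j := by
    intro j
    rcases le_or_gt (P j) c with hj | hj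
    · exact hmin j hj
    · exact (hmin i₁ hi₁).trans ((hiff i₁ j _ hi₁ hj).1 (hm₂ i₁ j hj))
  refine ⟨m i₁, hm₀ i₁, i, hopt, hi, ?_⟩
  -- Thus a nonzero multiplier is a tie between the optimal `i` and some `j` above the budget, which
  -- is then optimal too.
  have hmi : m i = m i₁ := by
    refine le_antisymm ?_ (hmin₁ i hi)
    rcases hm₁ i with h | ⟨j, hj, h⟩
    · rw [h]; exact hm₀ i₁
    · rw [h]; exact (hiff i j _ hi hj).2 (hopt j)
  rcases hm₁ i with h | ⟨j, hj, h⟩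
  · exact Or.inl (hmi ▸ h)
  · right
    refine ⟨j, fun k => le_trans ?_ (hopt k), hj⟩
    have hne : P j - P i ≠ 0 := by linarith
    have : m i₁ * (P j - P i) = D i - D j := by rw [← hmi, h, hcross]; field_simp
    linarith

end LinkModel

/-! ### Randomization in one state and the constrained optimum -/

namespace LinkModel

open Matrix

variable {Q A S L : ℕ} {M : LinkModel Q A S L} {lam g : ℝ} {V : State Q A L → ℝ}

lemma mix_apply_of_eq {θ : ℝ} {f f' : State Q A L → Fin (S + 1)} {z : State Q A L}
    (h : f' z = f z) : mix θ f f' z = pure f z := by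
  funext s
  simp only [mix, pure, h]
  ring

lemma mix_ne_zero {θ : ℝ} {f f' : State Q A L → Fin (S + 1)} {z : State Q A L} {s : Fin (S + 1)}
    (h : mix θ f f' z s ≠ 0) : s = f z ∨ s = f' z := by
  by_contra hcon
  rw [not_or] at hcon
  exact h (by simp [mix, pure, hcon.1, hcon.2])

/-- Two rules that differ in a single state can be randomized to meet a power level in between. -/
lemma exists_mix_power {f f' : State Q A L → Fin (S + 1)} (hf : IsRule f) (hf' : IsRule f')
    {z₀ : State Q A L} (hz₀ : ∀ z, z ≠ z₀ → f' z = f z) {p₀ p₁ τ : ℝ}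
    (hp₀ : M.HasPower (pure f) p₀) (hp₁ : M.HasPower (pure f') p₁) (h0 : 0 ≤ τ) (h1 : τ ≤ 1) :
    ∃ θ, 0 ≤ θ ∧ θ ≤ 1 ∧ M.HasPower (mix θ f f') ((1 - τ) * p₀ + τ * p₁) := by
  have : Nonempty (State Q A L) := ⟨z₀⟩
  obtain ⟨π₀, hπ₀⟩ := exists_isStationaryLaw
    (transition_mem_rowStochastic (M := M) (isPolicy_pure hf.feasible))
  obtain ⟨π₁, hπ₁⟩ := exists_isStationaryLaw
    (transition_mem_rowStochastic (M := M) (isPolicy_pure hf'.feasible))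
  have h1' : 0 ≤ 1 - τ := by linarith
  set π : State Q A L → ℝ := (1 - τ) • π₀ + τ • π₁ with hπdef
  have hπz : ∀ z, π z = (1 - τ) * π₀ z + τ * π₁ z := fun z => rfl
  have ha : ∀ z, 0 ≤ (1 - τ) * π₀ z := fun z => mul_nonneg h1' (hπ₀.nonneg z)
  have hb : ∀ z, 0 ≤ τ * π₁ z := fun z => mul_nonneg h0 (hπ₁.nonneg z)
  -- The conditional weight of `π₁` at `z₀` in the mixed law; with it, `π` is stationary for the
  -- randomized policy. If `π z₀ = 0`, both contributions at `z₀` vanish and the value of `θ` is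
  -- immaterial.
  set θ := τ * π₁ z₀ / π z₀ with hθ
  have hθ0 : 0 ≤ θ := div_nonneg (hb z₀) (by rw [hπz]; exact add_nonneg (ha z₀) (hb z₀))
  have hθ1 : θ ≤ 1 := div_le_one_of_le₀ (by rw [hπz]; linarith [ha z₀])
    (by rw [hπz]; exact add_nonneg (ha z₀) (hb z₀))
  have hθπ : π z₀ * θ = τ * π₁ z₀ := by
    by_cases hz : π z₀ = 0
    · have := ha z₀
      have := hb z₀
      have := hπz z₀
      rw [hz, zero_mul]
      linarith
    · rw [hθ]; field_simp
  have key : ∀ z (κ : Fin (S + 1) → ℝ), π z * ∑ s, mix θ f f' z s * κ s =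
      (1 - τ) * (π₀ z * ∑ s, pure f z s * κ s) + τ * (π₁ z * ∑ s, pure f' z s * κ s) := by
    intro z κ
    rw [sum_mix_mul, sum_pure_mul, sum_pure_mul]
    by_cases hz : z = z₀
    · subst hz
      have := hπz z
      linear_combination (κ (f' z) - κ (f z)) * hθπ + κ (f z) * this
    · rw [hz₀ z hz, hπz]
      ring
  have hπ : IsStationaryLaw (M.transition (mix θ f f')) π := by
    refine ⟨fun z => add_nonneg (ha z) (hb z), ?_, ?_⟩
    · simp only [hπz, Finset.sum_add_distrib, ← Finset.mul_sum, hπ₀.sum_eq_one, hπ₁.sum_eq_one]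
      ring
    · have e : π ᵥ* M.transition (mix θ f f') = (1 - τ) • (π₀ ᵥ* M.transition (pure f)) +
          τ • (π₁ ᵥ* M.transition (pure f')) := by
        funext y
        simp only [vecMul, dotProduct, transition, Pi.add_apply, Pi.smul_apply, smul_eq_mul]
        rw [Finset.mul_sum, Finset.mul_sum, ← Finset.sum_add_distrib]
        exact Finset.sum_congr rfl fun z _ => key z _
      rw [e, hπ₀.vecMul_eq, hπ₁.vecMul_eq]
  obtain ⟨p, w, hw⟩ := exists_power_mix (M := M) hθ0 hθ1 hf hf'
  refine ⟨θ, hθ0, hθ1, ?_⟩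
  have hp : M.HasPower (mix θ f f') p := ⟨w, hw⟩
  have e : p = (1 - τ) * p₀ + τ * p₁ := by
    rw [← hp.dotProduct_eq hπ, ← hp₀.dotProduct_eq hπ₀, ← hp₁.dotProduct_eq hπ₁]
    simp only [dotProduct, policyCost]
    rw [Finset.mul_sum, Finset.mul_sum, ← Finset.sum_add_distrib]
    exact Finset.sum_congr rfl fun z _ => key z _
  rwa [← e]

/-- On a path of unit steps between two optimal rules, the power crosses any level that separates
their powers between two optimal rules that differ in a single state. -/
lemma exists_crossing {P : (State Q A L → Fin (S + 1)) → ℝ} {c : ℝ}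
    {f f' : State Q A L → Fin (S + 1)} (hf : IsRule f) (hf' : IsRule f') (hle : f ≤ f')
    (hsep : ¬ (P f ≤ c ↔ P f' ≤ c)) :
    ∃ k k' z₀, IsRule k ∧ IsRule k' ∧ f ≤ k ∧ k ≤ f' ∧ f ≤ k' ∧ k' ≤ f' ∧
      (k' z₀ : ℕ) = k z₀ + 1 ∧ (∀ z, z ≠ z₀ → k' z = k z) ∧ ¬ (P k ≤ c ↔ P k' ≤ c) := by
  induction hn : ∑ z, ((f' z : ℕ) - (f z : ℕ)) using Nat.strong_induction_on generalizing f with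
  | _ n ih =>
    have hne : f ≠ f' := by rintro rfl; exact hsep Iff.rfl
    obtain ⟨k, z₀, hk, h1, h2, h3, h4⟩ := exists_update_rule hf hf' hle hne
    by_cases hfk : P f ≤ c ↔ P k ≤ c
    · have hlt : ∑ z, ((f' z : ℕ) - (k z : ℕ)) < n := by
        rw [← hn]
        refine Finset.sum_lt_sum (fun z _ => ?_) ⟨z₀, Finset.mem_univ _, ?_⟩
        · have : (f z : ℕ) ≤ k z := h1 z
          omega
        · have : (k z₀ : ℕ) ≤ f' z₀ := h2 z₀
          omega
      obtain ⟨l, l', z₁, a1, a2, a3, a4, a5, a6, a7⟩ :=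
        ih _ hlt hk h2 (fun h => hsep (hfk.trans h)) rfl
      exact ⟨l, l', z₁, a1, a2, h1.trans a3, a4, h1.trans a5, a6, a7⟩
    · exact ⟨f, k, z₀, hf, hk, le_rfl, hle, h1, h2, h3, h4, hfk⟩

/-- For every sustainable power budget there is a Bellman-optimal policy that meets the
complementary slackness condition and randomizes between two rules differing in one state. -/
lemma exists_optimal_mix (hP : M.PowerSubmodular) {Pth : ℝ}
    (hPth : ∃ F : State Q A L → Fin (S + 1) → ℝ, IsPolicy F ∧
      ∃ z p, M.HasAvgPower F z p ∧ p ≤ Pth) :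
    ∃ (f f' : State Q A L → Fin (S + 1)) (θ : ℝ), IsRule f ∧ IsRule f' ∧ 0 ≤ θ ∧ θ ≤ 1 ∧
      (∀ z, M.IsOptimal Pth (mix θ f f') z) ∧
      (f' = f ∨ ∃ z₀, (f' z₀ : ℕ) = f z₀ + 1 ∧ ∀ z, z ≠ z₀ → f' z = f z) := by
  obtain ⟨F₁, hF₁, z₁, p₁, hp₁, hle₁⟩ := hPth
  have : Nonempty (State Q A L) := ⟨z₁⟩
  let R := {f : State Q A L → Fin (S + 1) // IsRule f}
  choose π hπ using fun f : R => exists_isStationaryLaw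
    (transition_mem_rowStochastic (M := M) (isPolicy_pure f.2.feasible))
  choose P hPw using fun f : R => f.2.exists_hasPower M
  set D : R → ℝ := fun f => π f ⬝ᵥ M.delay with hD
  have hD0 : ∀ f, 0 ≤ D f := fun f => Finset.sum_nonneg fun z _ =>
    mul_nonneg ((hπ f).nonneg z)
      (mul_nonneg (one_div_nonneg.2 M.alpha_nonneg) (by positivity))
  have hlow : ∀ {lam g V}, M.IsBellman lam g V → ∀ f : R, g ≤ D f + lam * P f := by
    intro lam g V hB f
    rw [← (hPw f).dotProduct_eq (hπ f)]
    exact hB.le_stationary (isPolicy_pure f.2.feasible) (hπ f)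
  have hatt : ∀ {lam g V}, 0 ≤ lam → M.IsBellman lam g V → ∃ f : R, D f + lam * P f = g := by
    intro lam g V hl hB
    obtain ⟨f, hf, hopt, -⟩ := exists_least_rule hP hl hB.convex
    refine ⟨⟨f, hf⟩, ?_⟩
    rw [← (hPw ⟨f, hf⟩).dotProduct_eq (hπ ⟨f, hf⟩)]
    refine (hB.eq_stationary (isPolicy_pure hf.feasible) (fun z s hs => ?_) (hπ ⟨f, hf⟩)).symm
    rw [pure_ne_zero hs]
    exact hopt z
  -- Otherwise every rule exceeds `p₁` by a fixed margin, and a multiplier pricing this margin at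
  -- `|d| + 1` contradicts the Lagrangian bound for `F₁`.
  have hfeas : ∃ f, P f ≤ Pth := by
    by_contra! hcon
    obtain ⟨d, hd⟩ := exists_tendsto_cesaro (transition_mem_rowStochastic (M := M) hF₁) M.delay z₁
    have hR : Nonempty R := by
      obtain ⟨g, V, hB⟩ := M.exists_isBellman le_rfl
      exact ⟨(hatt le_rfl hB).choose⟩
    obtain ⟨m, hm⟩ := Finite.exists_min P
    have hδ : 0 < P m - p₁ := by linarith [hcon m]
    have hl : 0 ≤ (|d| + 1) / (P m - p₁) := by positivity
    obtain ⟨g, V, hB⟩ := M.exists_isBellman hl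
    obtain ⟨f, hf⟩ := hatt hl hB
    have h1 := hB.le_avg hF₁ z₁ hd hp₁
    have h2 := hD0 f
    have h3 := mul_le_mul_of_nonneg_left (hm f) hl
    have h4 : (|d| + 1) / (P m - p₁) * (P m - p₁) = |d| + 1 := by field_simp
    have h5 := le_abs_self d
    linarith
  obtain ⟨lam, hl, i, hi, hic, hcase⟩ := exists_multiplier P D hfeas
  obtain ⟨g, V, hB⟩ := M.exists_isBellman hl
  have hgain : ∀ j : R, (∀ k, D j + lam * P j ≤ D k + lam * P k) → D j + lam * P j = g := by
    intro j hj
    obtain ⟨f, hf⟩ := hatt hl hB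
    exact le_antisymm ((hj f).trans hf.le) (hlow hB j)
  -- Clipping changes `j` only off the support of `π j`, so this law stays stationary. It computes
  -- the power of both rules, as any stationary law does.
  have hclip : ∀ j : R, D j + lam * P j = g → ∃ k : R, (∀ z, M.IsOpt lam V z (k.1 z)) ∧
      P k = P j := by
    intro j hj
    obtain ⟨k, hk, hopt, heq⟩ := exists_clip hP hl hB.convex j.2
    have hst : IsStationaryLaw (M.transition (pure k)) (π j) :=
      isStationaryLaw_congr (hπ j) fun z hz => by
        have := hB.isOpt_of_stationary j.2.feasible (hπ j)
          (by rw [(hPw j).dotProduct_eq (hπ j)]; exact hj) z hz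
        funext s
        simp only [pure, heq z this]
    refine ⟨⟨k, hk⟩, hopt, ?_⟩
    rw [← (hPw ⟨k, hk⟩).dotProduct_eq hst, ← (hPw j).dotProduct_eq (hπ j)]
    simp only [dotProduct]
    refine Finset.sum_congr rfl fun z _ => ?_
    by_cases hz : π j z = 0
    · simp [hz]
    · have := hB.isOpt_of_stationary j.2.feasible (hπ j)
        (by rw [(hPw j).dotProduct_eq (hπ j)]; exact hj) z hz
      rw [policyCost_pure, policyCost_pure, heq z this]
  obtain ⟨k, hk, hPk⟩ := hclip i (hgain i hi)
  rcases hcase with h0 | ⟨j, hj, hjc⟩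
  · refine ⟨k.1, k.1, 0, k.2, k.2, le_rfl, zero_le_one, fun z => ?_, Or.inl rfl⟩
    rw [mix_self]
    refine hB.isOptimal hl (isPolicy_pure k.2.feasible) (fun z s hs => ?_) (hPw k)
      (hPk ▸ hic) (Or.inl h0) z
    rw [pure_ne_zero hs]
    exact hk z
  obtain ⟨k', hk', hPk'⟩ := hclip j (hgain j hj)
  classical
  -- Only values at rules matter; zero is a dummy elsewhere.
  let P' : (State Q A L → Fin (S + 1)) → ℝ := fun f => if h : IsRule f then P ⟨f, h⟩ else 0
  have hP' : ∀ f : R, P' f.1 = P f := fun f => dif_pos f.2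
  have hsep : ¬ (P' k.1 ≤ Pth ↔ P' k'.1 ≤ Pth) := by
    rw [hP', hP', hPk, hPk']
    exact fun h => absurd (h.1 hic) (not_le.2 hjc)
  have hbetween : ∀ l : State Q A L → Fin (S + 1), k.1 ⊓ k'.1 ≤ l → (l ≤ k.1 ∨ l ≤ k'.1) →
      ∀ z, M.IsOpt lam V z (l z) := by
    intro l h1 h2 z
    have hinf : M.IsOpt lam V z ((k.1 ⊓ k'.1) z) := by
      rcases min_choice (k.1 z) (k'.1 z) with h | h
      · simpa only [Pi.inf_apply, h] using hk z
      · simpa only [Pi.inf_apply, h] using hk' z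
    rcases h2 with h | h
    · exact IsOpt.inner hB.convex hl S (by omega) hinf (hk z) (h1 z) (h z)
    · exact IsOpt.inner hB.convex hl S (by omega) hinf (hk' z) (h1 z) (h z)
  have hpair : ∃ l l' z₀, IsRule l ∧ IsRule l' ∧ (∀ z, M.IsOpt lam V z (l z)) ∧
      (∀ z, M.IsOpt lam V z (l' z)) ∧ (l' z₀ : ℕ) = l z₀ + 1 ∧ (∀ z, z ≠ z₀ → l' z = l z) ∧
      ¬ (P' l ≤ Pth ↔ P' l' ≤ Pth) := by
    -- The two rules need not be comparable, so the path runs through their infimum and one of its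
    -- legs crosses the budget.
    by_cases hc : P' (k.1 ⊓ k'.1) ≤ Pth ↔ P' k.1 ≤ Pth
    · obtain ⟨l, l', z₀, a1, a2, a3, a4, a5, a6, a7, a8, a9⟩ :=
        exists_crossing (k.2.inf k'.2) k'.2 inf_le_right (fun h => hsep (hc.symm.trans h))
      exact ⟨l, l', z₀, a1, a2, hbetween l a3 (Or.inr a4), hbetween l' a5 (Or.inr a6), a7, a8, a9⟩
    · obtain ⟨l, l', z₀, a1, a2, a3, a4, a5, a6, a7, a8, a9⟩ :=
        exists_crossing (k.2.inf k'.2) k.2 inf_le_left hc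
      exact ⟨l, l', z₀, a1, a2, hbetween l a3 (Or.inl a4), hbetween l' a5 (Or.inl a6), a7, a8, a9⟩
  obtain ⟨l, l', z₀, hl₁, hl₂, ho₁, ho₂, hz₀, hzne, hcross⟩ := hpair
  rw [hP' ⟨l, hl₁⟩, hP' ⟨l', hl₂⟩] at hcross
  have hτ : ∃ τ, 0 ≤ τ ∧ τ ≤ 1 ∧ (1 - τ) * P ⟨l, hl₁⟩ + τ * P ⟨l', hl₂⟩ = Pth := by
    set x := P ⟨l, hl₁⟩
    set y := P ⟨l', hl₂⟩
    rcases le_or_gt x Pth with hx | hx <;> rcases le_or_gt y Pth with hy | hy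
    · exact absurd ⟨fun _ => hy, fun _ => hx⟩ hcross
    · have hxy : 0 < y - x := by linarith
      refine ⟨(Pth - x) / (y - x), div_nonneg (by linarith) hxy.le,
        (div_le_one hxy).2 (by linarith), ?_⟩
      field_simp
      ring
    · have hxy : 0 < x - y := by linarith
      refine ⟨(x - Pth) / (x - y), div_nonneg (by linarith) hxy.le,
        (div_le_one hxy).2 (by linarith), ?_⟩
      field_simp
      ring
    · exact absurd ⟨fun h => absurd h (not_le.2 hx), fun h => absurd h (not_le.2 hy)⟩ hcross
  obtain ⟨τ, hτ0, hτ1, hτ⟩ := hτ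
  obtain ⟨θ, hθ0, hθ1, hθ⟩ := exists_mix_power hl₁ hl₂ hzne (hPw ⟨l, hl₁⟩) (hPw ⟨l', hl₂⟩) hτ0 hτ1
  rw [hτ] at hθ
  refine ⟨l, l', θ, hl₁, hl₂, hθ0, hθ1, fun z => ?_, Or.inr ⟨z₀, hz₀, hzne⟩⟩
  refine hB.isOptimal hl (isPolicy_mix hθ0 hθ1 hl₁.feasible hl₂.feasible) (fun z s hs => ?_) hθ
    le_rfl (Or.inr rfl) z
  rcases mix_ne_zero hs with rfl | rfl
  · exact ho₁ z
  · exact ho₂ z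

/-! ### From rules to thresholds -/

lemma IsRule.monotone {f : State Q A L → Fin (S + 1)} (hf : IsRule f) (a : Fin (A + 1)) (i : Fin L) :
    Monotone fun q => f (q, a, i) := by
  refine Fin.monotone_iff_le_succ.2 fun q => ?_
  exact hf.mono _ _ a i (by simp)

lemma IsRule.zero {f : State Q A L → Fin (S + 1)} (hf : IsRule f) (a : Fin (A + 1)) (i : Fin L) :
    (f (0, a, i) : ℕ) = 0 := by
  have := (hf.feasible (0, a, i)).2
  exact Nat.le_zero.1 this

/-- The threshold is the greatest queue length with rate at most `s`; one exists because an empty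
queue sends nothing. -/
lemma IsRule.exists_threshold {f : State Q A L → Fin (S + 1)} (hf : IsRule f) :
    ∃ t : Fin (S + 1) → Fin (A + 1) → Fin L → Fin (Q + 1),
      ∀ s a i q, q ≤ t s a i ↔ f (q, a, i) ≤ s := by
  have : ∀ s a i, ∃ t : Fin (Q + 1), ∀ q, q ≤ t ↔ f (q, a, i) ≤ s := by
    intro s a i
    obtain ⟨t, ht, hmax⟩ := Finset.exists_max_image
      (Finset.univ.filter fun q : Fin (Q + 1) => f (q, a, i) ≤ s) id
      ⟨0, Finset.mem_filter.2 ⟨Finset.mem_univ _, Fin.le_def.2 (by rw [hf.zero]; omega)⟩⟩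
    simp only [Finset.mem_filter, Finset.mem_univ, true_and, id] at ht hmax
    exact ⟨t, fun q => ⟨fun h => (hf.monotone a i h).trans ht, hmax q⟩⟩
  choose t ht using this
  exact ⟨t, ht⟩

/-- For `s = 0` both sides always hold, which is the purpose of the value `-1`. -/
lemma prevThreshold_lt_iff {f : State Q A L → Fin (S + 1)}
    {t : Fin (S + 1) → Fin (A + 1) → Fin L → Fin (Q + 1)}
    (ht : ∀ s a i q, q ≤ t s a i ↔ f (q, a, i) ≤ s) (s : Fin (S + 1)) (a : Fin (A + 1)) (i : Fin L)
    (q : Fin (Q + 1)) : prevThreshold t s a i < ((q : ℕ) : ℤ) ↔ s ≤ f (q, a, i) := by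
  unfold prevThreshold
  split_ifs with h
  · rw [Fin.le_def]
    constructor <;> intro <;> omega
  · have := ht ⟨s - 1, by omega⟩ a i q
    rw [Fin.le_def, Fin.le_def] at this
    simp only at this
    rw [Fin.le_def]
    omega

/-- Randomizing a rule at the upper end of a threshold interval gives the threshold structure. -/
lemma hasThresholds_mix {f f' : State Q A L → Fin (S + 1)}
    {t : Fin (S + 1) → Fin (A + 1) → Fin L → Fin (Q + 1)}
    (ht : ∀ s a i q, q ≤ t s a i ↔ f (q, a, i) ≤ s) {a₀ : Fin (A + 1)} {i₀ : Fin L}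
    {s₀ : Fin (S + 1)} (hs₀ : f (t s₀ a₀ i₀, a₀, i₀) = s₀)
    (hf'₀ : (f' (t s₀ a₀ i₀, a₀, i₀) : ℕ) = s₀ ∨ (f' (t s₀ a₀ i₀, a₀, i₀) : ℕ) = s₀ + 1)
    (hne : ∀ z, z ≠ (t s₀ a₀ i₀, a₀, i₀) → f' z = f z) (θ : ℝ) :
    HasThresholds (mix θ f f') t s₀ a₀ i₀ := by
  have hprev := prevThreshold_lt_iff ht
  refine ⟨fun s s' a i h => ?_, fun q a i s h h1 h2 => ?_, fun q h1 h2 => ?_, ?_,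
    fun q a i s h1 h2 h3 => ?_⟩
  · exact (ht _ _ _ _).2 (((ht _ _ _ _).1 le_rfl).trans h)
  · have hs : s = f (q, a, i) := le_antisymm ((hprev _ _ _ _).1 h1) ((ht _ _ _ _).1 h2)
    have hz : (q, a, i) ≠ (t s₀ a₀ i₀, a₀, i₀) := by
      intro e
      have ea : a = a₀ := congrArg (fun z => z.2.1) e
      have ei : i = i₀ := congrArg (fun z => z.2.2) e
      rw [e, hs₀] at hs
      simp [ea, ei, hs] at h
    rw [mix_apply_of_eq (hne _ hz), pure, if_pos hs]
  · have hs : s₀ = f (q, a₀, i₀) := le_antisymm ((hprev _ _ _ _).1 h1) ((ht _ _ _ _).1 h2.le)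
    have hz : (q, a₀, i₀) ≠ (t s₀ a₀ i₀, a₀, i₀) := fun e => h2.ne (congrArg Prod.fst e)
    rw [mix_apply_of_eq (hne _ hz), pure, if_pos hs]
  · have e := sum_mix_mul θ f f' (t s₀ a₀ i₀, a₀, i₀)
      (fun s => if s = s₀ ∨ (s : ℕ) = (s₀ : ℕ) + 1 then 1 else 0)
    simp only [mul_ite, mul_one, mul_zero] at e
    rw [e, if_pos (Or.inl hs₀), if_pos (hf'₀.imp Fin.ext id)]
    ring
  · by_contra hcon
    by_cases hz : (q, a, i) = (t s₀ a₀ i₀, a₀, i₀)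
    · have eq : q = t s₀ a₀ i₀ := congrArg Prod.fst hz
      have ea : a = a₀ := congrArg (fun z => z.2.1) hz
      have ei : i = i₀ := congrArg (fun z => z.2.2) hz
      refine h3 ⟨ea, ei, eq, ?_⟩
      rcases mix_ne_zero hcon with h | h
      · exact Or.inl (by rw [h, hz, hs₀])
      · rw [h, hz]; exact hf'₀.imp Fin.ext id
    · rw [mix_apply_of_eq (hne _ hz)] at hcon
      have hs := pure_ne_zero hcon
      have k1 := (hprev s a i q).2 hs.le
      have k2 := (ht s a i q).2 hs.ge
      by_cases hb : a ≠ a₀ ∨ s ≠ s₀ ∨ i ≠ i₀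
      · exact h1 ⟨hb, k1, k2⟩
      · simp only [ne_eq, not_or, not_not] at hb
        obtain ⟨rfl, rfl, rfl⟩ := hb
        exact h2 ⟨rfl, rfl, rfl, k1, lt_of_le_of_ne k2 fun e => hz (by rw [e])⟩

end LinkModel

theorem theorem9 {Q A S L : ℕ} (M : LinkModel Q A S L)
    (hP : ∀ i j : Fin L, i < j → ∀ s s' : ℕ, s < s' → s' ≤ S →
      M.P (M.h j) s' - M.P (M.h j) s ≤ M.P (M.h i) s' - M.P (M.h i) s)
    (Pth : ℝ)
    (hPth : ∃ F : LinkModel.State Q A L → Fin (S + 1) → ℝ, LinkModel.IsPolicy F ∧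
      ∃ z p, M.HasAvgPower F z p ∧ p ≤ Pth) :
    ∃ (F : LinkModel.State Q A L → Fin (S + 1) → ℝ)
      (t : Fin (S + 1) → Fin (A + 1) → Fin L → Fin (Q + 1)),
      (∀ z, M.IsOptimal Pth F z) ∧
      (∃ s₀ a₀ i₀, LinkModel.HasThresholds F t s₀ a₀ i₀) ∧
      ∀ (s : Fin (S + 1)) (a : Fin (A + 1)) (i j : Fin L), i < j → t s a j ≤ t s a i := by
  have hz₁ : Nonempty (LinkModel.State Q A L) := by
    obtain ⟨_, _, z, _⟩ := hPth
    exact ⟨z⟩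
  obtain ⟨f, f', θ, hf, hf', -, -, hopt, hdiff⟩ := LinkModel.exists_optimal_mix hP hPth
  obtain ⟨t, ht⟩ := hf.exists_threshold
  refine ⟨LinkModel.mix θ f f', t, hopt, ?_, fun s a i j hij => ?_⟩
  · rcases hdiff with rfl | ⟨⟨q₀, a₀, i₀⟩, h₀, hne⟩
    -- Without randomization the exceptional triple is a formality. At the threshold of rate zero
    -- the rate is certainly zero, whereas a larger rate might never be used.
    · obtain ⟨⟨_, _, i₀⟩⟩ := hz₁
      have h0 : f' (t 0 0 i₀, 0, i₀) = 0 := le_antisymm ((ht _ _ _ _).1 le_rfl) (Fin.zero_le _)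
      exact ⟨0, 0, i₀, LinkModel.hasThresholds_mix ht h0 (Or.inl (congrArg Fin.val h0))
        (fun _ _ => rfl) θ⟩
    -- Since `f'` stays nondecreasing after the raise at `q₀`, the next queue length already has a
    -- greater rate under `f`; so `q₀` ends its interval.
    · have hq : t (f (q₀, a₀, i₀)) a₀ i₀ = q₀ := by
        refine le_antisymm (not_lt.1 fun hlt => ?_) ((ht _ _ _ _).2 le_rfl)
        have hlt' : (q₀ : ℕ) < t (f (q₀, a₀, i₀)) a₀ i₀ := hlt
        let q₁ : Fin (Q + 1) := ⟨q₀ + 1, by omega⟩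
        have h1 := (ht (f (q₀, a₀, i₀)) a₀ i₀ q₁).1 (Fin.le_def.2 (by simp only [q₁]; omega))
        have h2 := hf'.mono q₀ q₁ a₀ i₀ rfl
        have h3 : (q₁, a₀, i₀) ≠ (q₀, a₀, i₀) := fun e => by
          have := congrArg (fun z => (z.1 : ℕ)) e
          simp [q₁] at this
        rw [hne _ h3, h₀] at h2
        rw [Fin.le_def] at h1
        omega
      refine ⟨f (q₀, a₀, i₀), a₀, i₀, LinkModel.hasThresholds_mix ht (by rw [hq]) ?_ ?_ θ⟩
      · rw [hq]; exact Or.inr h₀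
      · rw [hq]; exact hne
  · have h : f (t s a j, a, j) ≤ s := (ht _ _ _ _).1 le_rfl
    exact (ht _ _ _ _).2 (le_trans (hf.channel _ a i j hij) h)
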